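/- Let $d,c\ge 0$ be integers. A translation invariant quantum random walk (QRW) on $\mathbb{Z}^d$ is given by a unitary operator $U$ (the coin) on $\mathbb{C}^c$ with orthonormal basis $e_1,\dots,e_c$, and jump vectors $j_1,\dots,j_c\in\mathbb{Z}^d$. Its evolution operator on $\ell^2(\mathbb{Z}^d)\otimes\mathbb{C}^c$ is $S=S_2S_1$, where $S_1=\mathrm{id}\otimes U$ and $S_2(x\otimes e_v)=(x+j_v)\otimes e_v$. For a unit vector $u\in\mathbb{C}^c$ put $p_T^{u}(x,v)=|\langle x\otimes e_v,\,S^T(0\otimes u)\rangle|^2$, let $\pi_T^u=\sum_{x,v}p^u_T(x,v)\,\delta_{x/T}$ be the law of the rescaled position at time $T\geq 1$, and let $P\subset\mathbb{R}^d$ be the convex hull of $j_1,\dots,j_c$. The limit measure $\pi_u$ of the QRW with initial state $u$ is the weak limit of $\pi_T^u$ as $T\to\infty$; the QRW localizes weakly if, for some $u$, $\pi_u$ has an atom. The QRW, started in $u$, localizes strongly at speed $s\in P$ if there are times $T_n\to\infty$, sites $x_n\in\mathbb{Z}^d$ and indices $v_n\in\{1,\dots,c\}$ such that $\liminf_{n\to\infty}p^u_{T_n}(x_n,v_n)>0$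 and $x_n/T_n\to s$. **Corollary (Quantization).** For every QRW and every unit vector $u\in\mathbb{C}^c$, the limit measure $\pi_u$ exists, and: 1. every atom of $\pi_u$ lies in $\frac1k\mathbb{Z}^d\cap P$ for some integer $1\le k\le c$; 2. conversely, if $\pi_u$ has an atom at a point $s\in\frac1k\mathbb{Z}^d\cap P$ with $1\le k\le c$, then the QRW started in $u$ localizes strongly at speed $s$; 3. if the QRW started in $u$ localizes strongly at speed $s$, then $s\in\frac1k\mathbb{Z}^d$ for some integer $1\le k\le c$; so the speeds at which localization occurs are rational, with a common denominator of their coordinates bounded by the dimension $c$ of the coin space. -/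

import Mathlib

open Filter Topology MeasureTheory

noncomputable section

/-- The coin space `ℂ^c`, with its standard orthonormal basis. -/
abbrev CoinSpace (c : ℕ) := EuclideanSpace ℂ (Fin c)

/-- The Hilbert space `ℓ²(ℤ^d) ⊗ ℂ^c`, realised as the square-summable functions `ℤ^d → ℂ^c`. -/
abbrev WalkSpace (d c : ℕ) := lp (fun _ : Fin d → ℤ => CoinSpace c) 2

/-- The data of a translation invariant quantum random walk on `ℤ^d`: a unitary coin acting on
the coin space, and a jump vector for each of the basis states. -/
structure QRW (d c : ℕ) where
  coin : CoinSpace c ≃ₗᵢ[ℂ] CoinSpace c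
  jump : Fin c → Fin d → ℤ

namespace QRW

variable {d c : ℕ}

lemma hasSum_norm_sq (ψ : WalkSpace d c) : HasSum (fun k => ‖ψ k‖ ^ 2) (‖ψ‖ ^ 2) := by
  have h := lp.hasSum_norm (p := 2) (by norm_num) ψ
  simpa using h

lemma memℓp_of_summable {f : (Fin d → ℤ) → CoinSpace c} (h : Summable fun k => ‖f k‖ ^ 2) :
    Memℓp f 2 := by
  apply memℓp_gen
  simpa using h

lemma norm_eq_of_hasSum {ψ : WalkSpace d c} {a : ℝ} (ha : 0 ≤ a)
    (h : HasSum (fun k => ‖ψ k‖ ^ 2) (a ^ 2)) : ‖ψ‖ = a :=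
  (pow_left_inj₀ (norm_nonneg _) ha two_ne_zero).1 ((hasSum_norm_sq ψ).unique h)

lemma hasSum_coin (W : QRW d c) (ψ : WalkSpace d c) :
    HasSum (fun k => ‖W.coin (ψ k)‖ ^ 2) (‖ψ‖ ^ 2) := by
  simpa using hasSum_norm_sq ψ

/-- `S₁ = id ⊗ U`: the coin acts at each site. -/
def coinStep (W : QRW d c) : WalkSpace d c →ₗᵢ[ℂ] WalkSpace d c where
  toFun ψ := ⟨fun k => W.coin (ψ k), memℓp_of_summable (W.hasSum_coin ψ).summable⟩
  map_add' ψ φ := by ext k : 2; exact map_add W.coin _ _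
  map_smul' a ψ := by ext k : 2; simp
  norm_map' ψ := norm_eq_of_hasSum (norm_nonneg _) (W.hasSum_coin ψ)

/-- The `v`-th layer is translated by `jump v`. -/
def shiftFun (W : QRW d c) (ψ : (Fin d → ℤ) → CoinSpace c) : (Fin d → ℤ) → CoinSpace c :=
  fun k => WithLp.toLp 2 fun v => ψ (k - W.jump v) v

lemma hasSum_shift (W : QRW d c) (ψ : WalkSpace d c) :
    HasSum (fun k => ‖W.shiftFun ψ k‖ ^ 2) (‖ψ‖ ^ 2) := by
  have h := hasSum_norm_sq ψ
  simp only [EuclideanSpace.norm_sq_eq] at h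
  have hv : ∀ v, Summable fun k => ‖ψ k v‖ ^ 2 := fun v =>
    Summable.of_nonneg_of_le (fun _ => by positivity)
      (fun k => Finset.single_le_sum (f := fun v => ‖ψ k v‖ ^ 2) (fun _ _ => by positivity)
        (Finset.mem_univ v)) h.summable
  have h1 : HasSum (fun k => ∑ v, ‖ψ k v‖ ^ 2) (∑ v, ∑' k, ‖ψ k v‖ ^ 2) :=
    hasSum_sum fun v _ => (hv v).hasSum
  rw [h.unique h1]
  simp only [EuclideanSpace.norm_sq_eq]
  exact hasSum_sum fun v _ => (Equiv.subRight (W.jump v)).hasSum_iff.2 (hv v).hasSum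

/-- `S₂ : k ⊗ e_v ↦ (k + jump v) ⊗ e_v`. -/
def shiftStep (W : QRW d c) : WalkSpace d c →ₗᵢ[ℂ] WalkSpace d c where
  toFun ψ := ⟨W.shiftFun ψ, memℓp_of_summable (W.hasSum_shift ψ).summable⟩
  map_add' ψ φ := by ext k v; rfl
  map_smul' a ψ := by ext k v; simp [shiftFun]
  norm_map' ψ := norm_eq_of_hasSum (norm_nonneg _) (W.hasSum_shift ψ)

/-- One step of the walk, `S = S₂ ∘ S₁`. -/
def step (W : QRW d c) : WalkSpace d c →ₗᵢ[ℂ] WalkSpace d c :=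
  W.shiftStep.comp W.coinStep

/-- The state `k ⊗ u`. -/
def ket (k : Fin d → ℤ) (u : CoinSpace c) : WalkSpace d c := lp.single 2 k u

/-- The amplitude `⟨k ⊗ e_v, S^T (0 ⊗ u)⟩`. -/
def amplitude (W : QRW d c) (u : CoinSpace c) (T : ℕ) (k : Fin d → ℤ) (v : Fin c) : ℂ :=
  inner ℂ (ket k (EuclideanSpace.single v 1)) ((W.step ^ T) (ket 0 u))

/-- The probability to find the walk started at `0 ⊗ u` in the state `k ⊗ e_v` at time `T`. -/
def prob (W : QRW d c) (u : CoinSpace c) (T : ℕ) (k : Fin d → ℤ) (v : Fin c) : ℝ :=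
  ‖W.amplitude u T k v‖ ^ 2

/-- The probability to find the walk started at `0 ⊗ u` at the site `k` at time `T`. -/
def siteProb (W : QRW d c) (u : CoinSpace c) (T : ℕ) (k : Fin d → ℤ) : ℝ :=
  ∑ v, W.prob u T k v

/-- A lattice vector as a point of `ℝ^d`. -/
def latticePoint (k : Fin d → ℤ) : EuclideanSpace ℝ (Fin d) := WithLp.toLp 2 fun i => (k i : ℝ)

/-- The law of the rescaled position (site at time `T`, divided by `T`), as a measure. -/
def rescaledMeasure (W : QRW d c) (u : CoinSpace c) (T : ℕ) :
    Measure (EuclideanSpace ℝ (Fin d)) :=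
  Measure.sum fun k : Fin d → ℤ =>
    ENNReal.ofReal (W.siteProb u T k) • Measure.dirac ((T : ℝ)⁻¹ • latticePoint k)

lemma hasSum_siteProb (W : QRW d c) {u : CoinSpace c} (hu : ‖u‖ = 1) (T : ℕ) :
    HasSum (W.siteProb u T) 1 := by
  have h := hasSum_norm_sq ((W.step ^ T) (ket 0 u))
  rw [LinearIsometry.norm_map, ket, lp.norm_single (by norm_num), hu, one_pow] at h
  convert h using 2 with k
  simp [siteProb, prob, amplitude, ket, lp.inner_single_left, EuclideanSpace.norm_sq_eq,
    EuclideanSpace.inner_single_left]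

lemma isProbabilityMeasure_rescaledMeasure (W : QRW d c) {u : CoinSpace c} (hu : ‖u‖ = 1)
    (T : ℕ) : IsProbabilityMeasure (W.rescaledMeasure u T) := by
  refine ⟨?_⟩
  have h := W.hasSum_siteProb hu T
  rw [rescaledMeasure, Measure.sum_apply _ MeasurableSet.univ]
  simp only [Measure.smul_apply, measure_univ, smul_eq_mul, mul_one]
  rw [← ENNReal.ofReal_tsum_of_nonneg _ h.summable, h.tsum_eq, ENNReal.ofReal_one]
  exact fun k => Finset.sum_nonneg fun v _ => by unfold prob; positivity

/-- The law of the rescaled position, for a normalised initial coin state `u`. -/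
def rescaledLaw (W : QRW d c) (u : CoinSpace c) (hu : ‖u‖ = 1) (T : ℕ) :
    ProbabilityMeasure (EuclideanSpace ℝ (Fin d)) :=
  ⟨W.rescaledMeasure u T, W.isProbabilityMeasure_rescaledMeasure hu T⟩

/-- `μ` is the limit measure of the walk with initial coin state `u`: the weak limit of the laws
of the rescaled position. -/
def IsLimitMeasure (W : QRW d c) (u : CoinSpace c) (hu : ‖u‖ = 1)
    (μ : ProbabilityMeasure (EuclideanSpace ℝ (Fin d))) : Prop :=
  Tendsto (W.rescaledLaw u hu) atTop (𝓝 μ)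

/-- `s` is an atom of `μ`. -/
def IsAtom (μ : ProbabilityMeasure (EuclideanSpace ℝ (Fin d)))
    (s : EuclideanSpace ℝ (Fin d)) : Prop :=
  0 < (μ : Measure (EuclideanSpace ℝ (Fin d))) {s}

/-- The convex hull `P` of the jump vectors. -/
def jumpHull (W : QRW d c) : Set (EuclideanSpace ℝ (Fin d)) :=
  convexHull ℝ (Set.range fun v => latticePoint (W.jump v))

/-- Strong localization at asymptotic speed `s`, with initial coin state `u`. -/
def StronglyLocalizesAt (W : QRW d c) (u : CoinSpace c) (s : EuclideanSpace ℝ (Fin d)) : Prop :=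
  s ∈ W.jumpHull ∧ ∃ (T : ℕ → ℕ) (k : ℕ → Fin d → ℤ) (v : ℕ → Fin c),
    Tendsto T atTop atTop ∧
    0 < liminf (fun n => W.prob u (T n) (k n) (v n)) atTop ∧
    Tendsto (fun n => (T n : ℝ)⁻¹ • latticePoint (k n)) atTop (𝓝 s)

/-- The lattice `(1/k) ℤ^d` (for `k ≥ 1`). -/
def fractionLattice (d k : ℕ) : Set (EuclideanSpace ℝ (Fin d)) :=
  {s | ∃ l : Fin d → ℤ, s = (k : ℝ)⁻¹ • latticePoint l}

end QRW

end

/-! In momentum space the walk acts as a unitary matrix M(z) (`symbol`) at each point z of the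
torus. The characteristic function of the rescaled position at ξ is the integral over z of ⟨M(z)^T
u, (e^{iA/T} M(z))^T u⟩, where A is diagonal with entries j_v·ξ. Take an eigenbasis b_i of M(z),
with eigenvalues l_i, that also diagonalises the compressions of A to the eigenspaces, with values
α_i. Then (e^{iA/T} M(z))^T b_i = e^{iα_i} l_i^T b_i + o(1) (`IsAdaptedBasis.tendsto_pow_sub`): the
α_i are the group velocities in the direction ξ. Hence the integrand converges, and tightness gives
the limit measure.

For an atom at s, replace j_v by j_v - s and fix a direction θ. Averages of the characters
e^{inτθ·(x-s)} over n bound the mass of the atom by the mean mass of u on the eigenvectors with α_i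
= 0 (`exists_stationaryMass`). Along a line of direction θ the matrices form an analytic family. If
stationary eigenvalues are chosen at parameters that accumulate, one of them is an eigenvalue of the
whole family (`exists_flat_root`), so the exceptional parameters form a null set. For generic θ the
characteristic determinant, a trigonometric polynomial, vanishes on all of ℝ^d once it vanishes on
the line. The eigenvalue l therefore lies on a flat band (`IsFlat`): l e^{is·y} is an eigenvalue of
M(z + y/2π) for every y.

A closed loop n of the torus returns to M(z) and multiplies l by e^{2πi s·n}. As M(z) has at most c
eigenvalues, these phases form a finite group of some order k ≤ c, so ks = m is integral. Moreover
l^k = μ χ_m(z), where χ_m is the character of frequency m and μ lies in a finite set. If the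
amplitudes at the sites nm at times kn tended to zero, their ergodic averages would make u
orthogonal, for almost every z, to all eigenvectors with l^k = μ χ_m(z)
(`ae_inner_eq_zero_of_tendsto`). This contradicts the atom, so the walk localizes strongly at s.
Conversely, strong localization at s keeps a fixed mass in every ball around s and so produces an
atom, which makes s rational. -/

noncomputable section

/-! ### Spectral decomposition of an isometry, refined by a symmetric operator. -/

section Adapted

variable {E : Type*} [NormedAddCommGroup E] [InnerProductSpace ℂ E] {n : ℕ}

/-- An orthonormal eigenbasis of the isometry `U` which also diagonalises the compressions of `A`
to the eigenspaces of `U`. -/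
structure IsAdaptedBasis (U : E →ₗᵢ[ℂ] E) (A : E →ₗ[ℂ] E) (b : OrthonormalBasis (Fin n) ℂ E)
    (l : Fin n → ℂ) (a : Fin n → ℝ) : Prop where
  norm_eq_one : ∀ i, ‖l i‖ = 1
  apply_eq : ∀ i, U (b i) = l i • b i
  inner_eq : ∀ i w, U w = l i • w → inner ℂ w (A (b i)) = a i * inner ℂ w (b i)

lemma LinearIsometry.norm_eigenvalue_eq_one (U : E →ₗᵢ[ℂ] E) {x : E} {l : ℂ} (hx : x ≠ 0)
    (h : U x = l • x) : ‖l‖ = 1 := by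
  have := U.norm_map x
  rw [h, norm_smul] at this
  exact mul_right_cancel₀ (norm_ne_zero_iff.2 hx) (by rw [this, one_mul])

lemma LinearIsometry.inner_eq_zero_of_eigenvalue_ne (U : E →ₗᵢ[ℂ] E) {x y : E} {l m : ℂ}
    (hx : U x = l • x) (hy : U y = m • y) (h : l ≠ m) : inner ℂ x y = 0 := by
  by_cases hx0 : x = 0
  · simp [hx0]
  have hl := U.norm_eigenvalue_eq_one hx0 hx
  have h1 := U.inner_map_map x y
  rw [hx, hy, inner_smul_left, inner_smul_right, ← mul_assoc] at h1
  have h2 : (starRingEnd ℂ) l * l = 1 := by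
    rw [mul_comm, Complex.mul_conj, Complex.normSq_eq_norm_sq, hl]; simp
  by_contra h0
  have h3 : (starRingEnd ℂ) l * m = 1 := mul_right_cancel₀ h0 (by rw [h1, one_mul])
  apply h
  have h4 : (starRingEnd ℂ) l ≠ 0 := fun h0 => by simp [h0] at h2
  exact mul_left_cancel₀ h4 (h2.trans h3.symm)

variable [FiniteDimensional ℂ E]

/-- The orthogonal complement of the sum of the eigenspaces is invariant: an eigenvector x equals `U
(l⁻¹ • x)`, and `U` preserves inner products. Were the complement nonzero, it would contain an
eigenvector, orthogonal to itself. -/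
lemma LinearIsometry.iSup_eigenspace_eq_top (U : E →ₗᵢ[ℂ] E) :
    (⨆ l, Module.End.eigenspace U.toLinearMap l) = ⊤ := by
  set S := ⨆ l, Module.End.eigenspace U.toLinearMap l with hS
  rw [← Submodule.orthogonal_eq_bot_iff]
  by_contra hne
  have hmaps : ∀ y ∈ Sᗮ, U.toLinearMap y ∈ Sᗮ := by
    intro y hy
    rw [hS, ← Submodule.iInf_orthogonal, Submodule.mem_iInf] at hy ⊢
    intro l
    rw [Submodule.mem_orthogonal]
    intro x hx
    by_cases hx0 : x = 0
    · simp [hx0]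
    have hx' := Module.End.mem_eigenspace_iff.1 hx
    have hl := U.norm_eigenvalue_eq_one hx0 hx'
    have hl0 : l ≠ 0 := fun h => by simp [h] at hl
    have h1 : x = U (l⁻¹ • x) := by
      rw [map_smul]
      change x = l⁻¹ • U.toLinearMap x
      rw [hx', smul_smul, inv_mul_cancel₀ hl0, one_smul]
    rw [h1]
    change inner ℂ (U (l⁻¹ • x)) (U y) = 0
    rw [U.inner_map_map, inner_smul_left, (Submodule.mem_orthogonal _ _).1 (hy l) x hx, mul_zero]
  have : Nontrivial Sᗮ := Submodule.nontrivial_iff_ne_bot.2 hne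
  obtain ⟨l, hl⟩ := Module.End.exists_eigenvalue (U.toLinearMap.restrict hmaps)
  obtain ⟨v, hv⟩ := hl.exists_hasEigenvector
  have h1 : U.toLinearMap v = l • (v : E) := by
    have := hv.apply_eq_smul
    simpa using congrArg Subtype.val this
  have h2 : (v : E) ∈ S := Submodule.mem_iSup_of_mem l (Module.End.mem_eigenspace_iff.2 h1)
  have h3 := Submodule.inner_right_of_mem_orthogonal h2 v.2
  rw [inner_self_eq_zero] at h3
  exact hv.2 (Subtype.ext h3)

/-- The eigenspaces of `U` are orthogonal and span, so it suffices to diagonalise inside each of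
them the compression of `A`, which is again symmetric. -/
theorem LinearIsometry.exists_isAdaptedBasis (hn : Module.finrank ℂ E = n) (U : E →ₗᵢ[ℂ] E)
    {A : E →ₗ[ℂ] E} (hA : A.IsSymmetric) :
    ∃ (b : OrthonormalBasis (Fin n) ℂ E) (l : Fin n → ℂ) (a : Fin n → ℝ),
      IsAdaptedBasis U A b l a := by
  classical
  let f : Module.End ℂ E := U.toLinearMap
  let V : f.Eigenvalues → Submodule ℂ E := fun l => Module.End.eigenspace f l
  have hV : OrthogonalFamily ℂ (fun i => V i) fun i => (V i).subtypeₗᵢ := by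
    refine OrthogonalFamily.of_pairwise fun i j hij x hx y hy => ?_
    exact U.inner_eq_zero_of_eigenvalue_ne (Module.End.mem_eigenspace_iff.1 hy)
      (Module.End.mem_eigenspace_iff.1 hx) (fun h => hij (Subtype.ext h.symm))
  have hsum : DirectSum.IsInternal V := by
    rw [hV.isInternal_iff, Submodule.orthogonal_eq_bot_iff, eq_top_iff,
      ← U.iSup_eigenspace_eq_top]
    refine iSup_le fun l => ?_
    by_cases hl : f.HasEigenvalue l
    · exact le_iSup V ⟨l, hl⟩
    · have : Module.End.eigenspace f l = ⊥ := by
        by_contra h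
        exact hl (Module.End.hasEigenvalue_iff.2 h)
      change Module.End.eigenspace f l ≤ _
      rw [this]; exact bot_le
  let C : ∀ i, V i →ₗ[ℂ] V i := fun i =>
    (V i).orthogonalProjectionOnto.toLinearMap ∘ₗ A ∘ₗ (V i).subtype
  have hC : ∀ i, (C i).IsSymmetric := by
    intro i x y
    simp only [C, LinearMap.comp_apply, ContinuousLinearMap.coe_coe, Submodule.coe_inner]
    have h1 := Submodule.inner_orthogonalProjectionOnto_eq_of_mem_left x (A (y : E))
    have h2 := Submodule.inner_orthogonalProjectionOnto_eq_of_mem_right y (A (x : E))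
    simp only [Submodule.coe_inner] at h1 h2
    simp only [Submodule.subtype_apply]
    rw [h1, h2, hA]
  let B : OrthonormalBasis (Σ i, Fin (Module.finrank ℂ (V i))) ℂ E :=
    hsum.collectedOrthonormalBasis hV fun i => (hC i).eigenvectorBasis rfl
  have hcard : Fintype.card (Σ i, Fin (Module.finrank ℂ (V i))) = Fintype.card (Fin n) := by
    rw [← Module.finrank_eq_card_basis B.toBasis, hn, Fintype.card_fin]
  let e := Fintype.equivOfCardEq hcard
  have hBmem : ∀ p, B p ∈ V p.1 := fun p =>
    DirectSum.IsInternal.collectedOrthonormalBasis_mem hsum hV _ p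
  have hBval : ∀ p, B p = (((hC p.1).eigenvectorBasis rfl p.2 : V p.1) : E) := by
    rintro ⟨p, q⟩
    simp [B, DirectSum.IsInternal.collectedOrthonormalBasis]
  have hU : ∀ p, U (B p) = ((p.1 : f.Eigenvalues) : ℂ) • B p := fun p =>
    Module.End.mem_eigenspace_iff.1 (hBmem p)
  have hA' : ∀ p w, U w = ((p.1 : f.Eigenvalues) : ℂ) • w →
      inner ℂ w (A (B p)) = ((hC p.1).eigenvalues rfl p.2 : ℝ) * inner ℂ w (B p) := by
    intro p w hw
    have hwV : w ∈ V p.1 := Module.End.mem_eigenspace_iff.2 hw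
    have h1 := Submodule.inner_orthogonalProjectionOnto_eq_of_mem_left (⟨w, hwV⟩ : V p.1) (A (B p))
    change inner ℂ ((⟨w, hwV⟩ : V p.1) : E) (A (B p)) = _
    rw [← h1]
    have h2 := (hC p.1).apply_eigenvectorBasis rfl p.2
    have h3 : (V p.1).orthogonalProjectionOnto (A (B p)) =
        C p.1 ((hC p.1).eigenvectorBasis rfl p.2) := by
      rw [hBval]; rfl
    rw [h3, h2, inner_smul_right, hBval p]
    rfl
  refine ⟨B.reindex e, fun i => ((e.symm i).1 : ℂ),
    fun i => (hC (e.symm i).1).eigenvalues rfl (e.symm i).2, fun i => ?_, fun i => ?_,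
    fun i w hw => ?_⟩
  · exact U.norm_eigenvalue_eq_one (B.toBasis.ne_zero (e.symm i)) (by simpa using hU (e.symm i))
  · simpa using hU (e.symm i)
  · rw [OrthonormalBasis.reindex_apply]
    exact hA' _ w hw

end Adapted

/-! ### First-order perturbation theory for a kicked isometry. -/

section Perturbation

open Complex

variable {E : Type*} [NormedAddCommGroup E] [InnerProductSpace ℂ E] {n : ℕ}
  {U : E →ₗᵢ[ℂ] E} {A : E →ₗ[ℂ] E} {b : OrthonormalBasis (Fin n) ℂ E} {l : Fin n → ℂ}
  {a : Fin n → ℝ}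

/-- The first-order correction of the eigenvector. The equation is solvable because the right-hand
side has no component in the eigenspace of `l i`, the basis being adapted, while `l i - U` is
invertible on the other eigenspaces. -/
lemma IsAdaptedBasis.exists_correction (h : IsAdaptedBasis U A b l a) (i : Fin n) :
    ∃ y, l i • y - U y = (I * l i) • (A (b i) - (a i : ℂ) • b i) := by
  set v := A (b i) - (a i : ℂ) • b i with hv
  refine ⟨∑ j, (if l j = l i then 0 else I * l i * inner ℂ (b j) v / (l i - l j)) • b j, ?_⟩
  rw [map_sum, Finset.smul_sum, ← Finset.sum_sub_distrib]
  conv_rhs => rw [← b.sum_repr' v, Finset.smul_sum]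
  refine Finset.sum_congr rfl fun j _ => ?_
  rw [map_smul, h.apply_eq, smul_smul, smul_smul, smul_smul, ← sub_smul]
  congr 1
  split_ifs with hj
  · have : inner ℂ (b j) v = 0 := by
      rw [hv, inner_sub_right, h.inner_eq i (b j) (by rw [h.apply_eq, hj]), inner_smul_right,
        sub_self]
    simp [this]
  · have : l i - l j ≠ 0 := sub_ne_zero.2 (Ne.symm hj)
    field_simp

lemma tendsto_inv_mul_exp_sub_one {ι : Type*} {F : Filter ι} {s : ι → ℂ}
    (hs : Tendsto s F (𝓝[≠] 0)) (z : ℂ) :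
    Tendsto (fun t => (s t)⁻¹ * (exp (z * s t) - 1)) F (𝓝 z) := by
  have h1 : HasDerivAt (fun w : ℂ => exp (z * w)) z 0 := by
    simpa using ((hasDerivAt_id (0 : ℂ)).const_mul z).cexp
  have h2 := h1.tendsto_slope.comp hs
  refine h2.congr fun t => ?_
  simp [slope_def_field, div_eq_inv_mul]

section Residual

variable {ι : Type*} {F : Filter ι} {s : ι → ℂ} {D : ι → E →ₗ[ℂ] E}

lemma tendsto_apply_of_tendsto_inv_smul (hs : Tendsto s F (𝓝[≠] 0))
    (hD : ∀ w, Tendsto (fun t => (s t)⁻¹ • (D t w - w)) F (𝓝 (I • A w))) (w : E) :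
    Tendsto (fun t => D t w) F (𝓝 w) := by
  have h0 : Tendsto s F (𝓝 0) := hs.mono_right nhdsWithin_le_nhds
  have h1 := (h0.smul (hD w)).add_const w
  rw [zero_smul, zero_add] at h1
  have hne : ∀ᶠ t in F, s t ≠ 0 := hs.eventually self_mem_nhdsWithin
  refine h1.congr' (hne.mono fun t ht => ?_)
  rw [smul_smul, mul_inv_cancel₀ ht, one_smul, sub_add_cancel]

/-- The vector `b i + s • y` is an eigenvector of `D s ∘ U` up to an error `o(s)`. -/
lemma IsAdaptedBasis.tendsto_residual (h : IsAdaptedBasis U A b l a)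
    (hs : Tendsto s F (𝓝[≠] 0))
    (hD : ∀ w, Tendsto (fun t => (s t)⁻¹ • (D t w - w)) F (𝓝 (I • A w))) {i : Fin n} {y : E}
    (hy : l i • y - U y = (I * l i) • (A (b i) - (a i : ℂ) • b i)) :
    Tendsto (fun t => (s t)⁻¹ • (D t (U (b i + s t • y)) -
      (exp (I * a i * s t) * l i) • (b i + s t • y))) F (𝓝 0) := by
  have h0 : Tendsto s F (𝓝 0) := hs.mono_right nhdsWithin_le_nhds
  have hne : ∀ᶠ t in F, s t ≠ 0 := hs.eventually self_mem_nhdsWithin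
  have e1 : Tendsto (fun t => exp (I * a i * s t)) F (𝓝 1) := by
    have : Continuous fun w : ℂ => exp (I * a i * w) := by fun_prop
    simpa [Function.comp_def] using (this.tendsto 0).comp h0
  have e2 := tendsto_inv_mul_exp_sub_one hs (I * a i)
  have e3 := tendsto_apply_of_tendsto_inv_smul hs hD (U y)
  have e4 := (((hD (b i)).const_smul (l i)).add e3).sub
    (((e2.mul_const (l i)).smul_const (b i)).add ((e1.mul_const (l i)).smul_const y))
  -- The first-order terms cancel exactly by the equation defining y.
  have e5 : l i • I • A (b i) + U y - ((I * a i * l i) • b i + (1 * l i) • y) = 0 := by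
    have : U y = l i • y - (I * l i) • (A (b i) - (a i : ℂ) • b i) := by rw [← hy]; abel
    rw [this]
    module
  rw [e5] at e4
  refine e4.congr' (hne.mono fun t ht => ?_)
  simp only [map_add, map_smul, h.apply_eq]
  have hinv : (s t)⁻¹ * s t = 1 := inv_mul_cancel₀ ht
  have h6 : (s t)⁻¹ • s t • (D t) (U y) = D t (U y) := by rw [smul_smul, hinv, one_smul]
  have h7 : (s t)⁻¹ • (exp (I * a i * s t) * l i) • s t • y
      = (exp (I * a i * s t) * l i) • y := by
    rw [smul_comm, smul_smul (s t)⁻¹, hinv, one_smul]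
  simp only [smul_add, smul_sub, h6, h7]
  module

end Residual

/-- An isometry does not amplify errors, so the errors of the single steps only add up. An error
o(1/T) per step thus stays o(1) after T steps. -/
lemma LinearIsometry.norm_pow_apply_sub_le (G : E →ₗᵢ[ℂ] E) {m : ℂ} (hm : ‖m‖ = 1) (x : E)
    (k : ℕ) : ‖(G ^ k) x - m ^ k • x‖ ≤ k * ‖G x - m • x‖ := by
  induction k with
  | zero => simp
  | succ k ih =>
    have h1 : (G ^ (k + 1)) x - m ^ (k + 1) • x
        = G ((G ^ k) x - m ^ k • x) + m ^ k • (G x - m • x) := by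
      rw [pow_succ' G, map_sub, map_smul, smul_sub, smul_smul, ← pow_succ]
      change G ((G ^ k) x) - _ = _
      abel
    rw [h1]
    refine (norm_add_le _ _).trans ?_
    rw [G.norm_map, norm_smul, norm_pow, hm, one_pow, one_mul]
    push_cast
    linarith

/-- The kicked evolution `(D_T U)^T`, where `D_T = 1 + iA/T + o(1/T)`. -/
theorem IsAdaptedBasis.tendsto_pow_sub (h : IsAdaptedBasis U A b l a) {D : ℕ → E →ₗᵢ[ℂ] E}
    (hD : ∀ w, Tendsto (fun T : ℕ => (T : ℂ) • (D T w - w)) atTop (𝓝 (I • A w))) (i : Fin n) :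
    Tendsto (fun T : ℕ => (((D T).comp U) ^ T) (b i) - (exp (I * a i) * l i ^ T) • b i) atTop
      (𝓝 0) := by
  obtain ⟨y, hy⟩ := h.exists_correction i
  have hs0 : Tendsto (fun T : ℕ => ((T : ℂ))⁻¹) atTop (𝓝 0) :=
    tendsto_inv_atTop_nhds_zero_nat (𝕜 := ℂ)
  have hs : Tendsto (fun T : ℕ => ((T : ℂ))⁻¹) atTop (𝓝[≠] 0) := by
    refine tendsto_nhdsWithin_iff.2 ⟨hs0, ?_⟩
    filter_upwards [eventually_gt_atTop 0] with T hT
    simpa using hT.ne'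
  have hr := h.tendsto_residual (D := fun T => (D T).toLinearMap) hs (by simpa using hD) hy
  have hx : Tendsto (fun T : ℕ => (T : ℂ)⁻¹ • y) atTop (𝓝 0) := by
    simpa using hs0.smul_const y
  have hbound := ((tendsto_norm_zero.comp hr).add
    ((tendsto_norm_zero.comp hx).add (tendsto_norm_zero.comp hx)))
  rw [add_zero, add_zero] at hbound
  refine squeeze_zero_norm' ?_ hbound
  filter_upwards [eventually_gt_atTop 0] with T hT
  have hT' : (T : ℂ) ≠ 0 := by exact_mod_cast hT.ne'
  -- The corrected vector x is an eigenvector up to o(1/T). Passing from `b i` to x and back costs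
  -- twice the norm of y/T.
  set x := b i + (T : ℂ)⁻¹ • y with hxdef
  set m := exp (I * a i * (T : ℂ)⁻¹) * l i with hm
  have hm1 : ‖m‖ = 1 := by
    have : I * (a i : ℂ) * (T : ℂ)⁻¹ = ((a i * (T : ℝ)⁻¹ : ℝ) : ℂ) * I := by push_cast; ring
    rw [hm, norm_mul, h.norm_eq_one, this, norm_exp_ofReal_mul_I, one_mul]
  have hmT : m ^ T = exp (I * a i) * l i ^ T := by
    rw [hm, mul_pow, ← exp_nat_mul]
    congr 2
    field_simp
  have h1 := LinearIsometry.norm_pow_apply_sub_le ((D T).comp U) hm1 x T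
  have h2 : (((D T).comp U) ^ T) (b i) - (exp (I * a i) * l i ^ T) • b i =
      ((((D T).comp U) ^ T) x - m ^ T • x) +
      (-(((D T).comp U) ^ T) ((T : ℂ)⁻¹ • y) + m ^ T • ((T : ℂ)⁻¹ • y)) := by
    rw [← hmT, hxdef, map_add, smul_add]
    abel
  rw [h2]
  refine (norm_add_le _ _).trans (add_le_add ?_ ((norm_add_le _ _).trans (le_of_eq ?_)))
  · refine h1.trans (le_of_eq ?_)
    rw [Function.comp_apply, norm_smul, inv_inv, norm_natCast]
    rfl
  · rw [norm_neg, LinearIsometry.norm_map, norm_smul (m ^ T), norm_pow, hm1, one_pow, one_mul]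
    rfl

/-! ### Order of vanishing of the characteristic determinant at a stationary eigenvalue. -/

section Determinant

variable {ι : Type*} {F : Filter ι} {s : ι → ℂ} {D : ι → E →ₗ[ℂ] E}

lemma OrthonormalBasis.tendsto_det (b : OrthonormalBasis (Fin n) ℂ E) {v : ι → Fin n → E}
    {v₀ : Fin n → E} (h : ∀ i, Tendsto (fun t => v t i) F (𝓝 (v₀ i))) :
    Tendsto (fun t => b.toBasis.det (v t)) F (𝓝 (b.toBasis.det v₀)) := by
  have hc : Continuous fun w : Fin n → E => b.toBasis.det w := by
    simp only [Module.Basis.det_apply]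
    refine Continuous.matrix_det (continuous_matrix fun i j => ?_)
    simp only [Module.Basis.toMatrix_apply, OrthonormalBasis.coe_toBasis_repr_apply,
      OrthonormalBasis.repr_apply_apply]
    fun_prop
  exact (hc.tendsto v₀).comp (tendsto_pi_nhds.2 h)

/-- If the compression of `A` to the eigenspace of `l₀` is singular, the characteristic
determinant of `D_s U` at `l₀` vanishes to an order above the multiplicity of `l₀`. -/
theorem IsAdaptedBasis.tendsto_det_div (h : IsAdaptedBasis U A b l a)
    (hs : Tendsto s F (𝓝[≠] 0))
    (hD : ∀ w, Tendsto (fun t => (s t)⁻¹ • (D t w - w)) F (𝓝 (I • A w))) {i₀ : Fin n}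
    (ha : a i₀ = 0) :
    Tendsto (fun t => LinearMap.det (l i₀ • LinearMap.id - D t ∘ₗ U.toLinearMap) /
      (s t) ^ (Finset.univ.filter fun i => l i = l i₀).card) F (𝓝 0) := by
  classical
  have h0 : Tendsto s F (𝓝 0) := hs.mono_right nhdsWithin_le_nhds
  have hne : ∀ᶠ t in F, s t ≠ 0 := hs.eventually self_mem_nhdsWithin
  obtain ⟨y, hy⟩ := h.exists_correction i₀
  have hres := h.tendsto_residual hs hD hy
  set N : ι → E →ₗ[ℂ] E := fun t => l i₀ • LinearMap.id - D t ∘ₗ U.toLinearMap with hN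
  have hNapp : ∀ t w, N t w = l i₀ • w - D t (U w) := fun t w => rfl
  -- Evaluate the determinant on the basis with `b i₀` replaced by its corrected vector. Each column
  -- from the eigenspace of `l i₀` is divided by s, which accounts for the power of s in the
  -- statement. The column of `i₀` is o(s), so it still tends to zero after the division and kills
  -- the limit.
  let v : ι → Fin n → E := fun t i => b i + if i = i₀ then s t • y else 0
  let sc : ι → Fin n → ℂ := fun t i => if l i = l i₀ then s t else 1
  let C : ι → Fin n → E := fun t i => (sc t i)⁻¹ • N t (v t i)
  let C₀ : Fin n → E := fun i => if i = i₀ then 0 else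
    if l i = l i₀ then -(l i₀ • I • A (b i)) else l i₀ • b i - l i • b i
  have hC : ∀ i, Tendsto (fun t => C t i) F (𝓝 (C₀ i)) := by
    intro i
    by_cases hi : i = i₀
    · subst hi
      have e1 := hres.neg
      simp only [neg_zero] at e1
      simp only [C, C₀, v, sc, if_true]
      refine e1.congr fun t => ?_
      rw [hNapp, ← smul_neg, neg_sub, ha]
      simp
    · by_cases hl : l i = l i₀
      · simp only [C, C₀, v, sc, hi, hl, if_true, if_false, add_zero]
        refine ((hD (b i)).const_smul (l i₀)).neg.congr fun t => ?_
        rw [hNapp, h.apply_eq, hl, map_smul, ← smul_sub, smul_comm, ← smul_neg, ← smul_neg, neg_sub]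
      · simp only [C, C₀, v, sc, hi, hl, if_false, add_zero, inv_one, one_smul]
        refine ((tendsto_apply_of_tendsto_inv_smul hs hD (b i)).const_smul (l i)).const_sub
          (l i₀ • b i) |>.congr fun t => ?_
        rw [hNapp, h.apply_eq, map_smul]
  have hv : ∀ i, Tendsto (fun t => v t i) F (𝓝 (b i)) := by
    intro i
    by_cases hi : i = i₀
    · simp only [v, hi, if_true]
      simpa using (h0.smul_const y).const_add (b i₀)
    · simp only [v, hi, if_false, add_zero]
      exact tendsto_const_nhds
  have hdC := b.tendsto_det hC
  have hdv := b.tendsto_det hv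
  have hz : b.toBasis.det C₀ = 0 := (b.toBasis.det).map_coord_zero i₀ (by simp [C₀])
  have ho : b.toBasis.det (fun i => b i) = 1 := by
    have := b.toBasis.det_self
    simpa using this
  rw [hz] at hdC
  rw [ho] at hdv
  have hlim := hdC.div hdv one_ne_zero
  rw [zero_div] at hlim
  refine hlim.congr' ?_
  filter_upwards [hne, hdv.eventually_ne one_ne_zero] with t ht hvt
  have e1 : (fun i => sc t i • C t i) = N t ∘ v t := by
    funext i
    have : sc t i ≠ 0 := by
      simp only [sc]; split_ifs
      · exact ht
      · exact one_ne_zero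
    simp [C, smul_smul, mul_inv_cancel₀ this]
  have e2 := b.toBasis.det.map_smul_univ (sc t) (C t)
  rw [e1, Module.Basis.det_comp] at e2
  have e3 : ∏ i, sc t i = s t ^ (Finset.univ.filter fun i => l i = l i₀).card := by
    simp [sc, Finset.prod_ite]
  rw [e3, smul_eq_mul] at e2
  rw [Pi.div_apply, div_eq_div_iff hvt (pow_ne_zero _ ht), e2]
  ring

lemma IsAdaptedBasis.rootMultiplicity_charpoly [FiniteDimensional ℂ E]
    (h : IsAdaptedBasis U A b l a) (z : ℂ) :
    U.toLinearMap.charpoly.rootMultiplicity z = (Finset.univ.filter fun i => l i = z).card := by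
  classical
  have h1 : LinearMap.toMatrix b.toBasis b.toBasis U.toLinearMap = Matrix.diagonal l := by
    ext i j
    rw [LinearMap.toMatrix_apply]
    simp [h.apply_eq, Matrix.diagonal_apply]
    aesop
  rw [← LinearMap.charpoly_toMatrix _ b.toBasis, h1, Matrix.charpoly_diagonal,
    ← Polynomial.count_roots]
  have h2 : (∏ i, (Polynomial.X - Polynomial.C (l i))) =
      ((Finset.univ.val.map l).map fun a => Polynomial.X - Polynomial.C a).prod := by
    rw [Multiset.map_map]; rfl
  rw [h2, Polynomial.roots_multiset_prod_X_sub_C, Multiset.count_map]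
  simp only [Finset.card, Finset.filter, eq_comm]

end Determinant

end Perturbation

/-! ### Polynomials with meromorphic coefficients, and their germs along an ultrafilter. -/

section MeromorphicFamilies

open Polynomial

/-- The punctured disc is the image of a half-plane under w ↦ z + exp w. -/
lemma isPreconnected_ball_diff_singleton (z : ℂ) {r : ℝ} (hr : 0 < r) :
    IsPreconnected (Metric.ball z r \ {z}) := by
  have h : Metric.ball z r \ {z} = (fun w => z + Complex.exp w) '' {w | w.re < Real.log r} := by
    ext x
    simp only [Set.mem_sdiff, Metric.mem_ball, Set.mem_singleton_iff, Set.mem_image,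
      Set.mem_ofPred_eq]
    constructor
    · rintro ⟨h1, h2⟩
      have h3 : x - z ≠ 0 := sub_ne_zero.2 h2
      refine ⟨Complex.log (x - z), ?_, by rw [Complex.exp_log h3]; ring⟩
      rw [Complex.log_re]
      exact Real.log_lt_log (norm_pos_iff.2 h3) (by rwa [← dist_eq_norm])
    · rintro ⟨w, hw, rfl⟩
      refine ⟨?_, by simp⟩
      rw [dist_eq_norm, add_sub_cancel_left, Complex.norm_exp]
      exact (Real.lt_log_iff_exp_lt hr).1 hw
  rw [h]
  refine (Convex.isPreconnected ?_).image _ (by fun_prop)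
  exact convex_halfSpace_re_lt _

/-- The ring of functions meromorphic at a point. -/
def meromorphicSubring (z : ℂ) : Subring (ℂ → ℂ) where
  carrier := {f | MeromorphicAt f z}
  mul_mem' := MeromorphicAt.mul
  one_mem' := MeromorphicAt.const 1 z
  add_mem' := MeromorphicAt.add
  zero_mem' := MeromorphicAt.const 0 z
  neg_mem' := MeromorphicAt.neg

variable {z : ℂ}

/-- Evaluation of a meromorphic function at a point. -/
def evalMer (z t : ℂ) : meromorphicSubring z →+* ℂ :=
  (Pi.evalRingHom (fun _ : ℂ => ℂ) t).comp (meromorphicSubring z).subtype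

@[simp] lemma evalMer_apply (t : ℂ) (f : meromorphicSubring z) : evalMer z t f = f.1 t := rfl

/-- The germ of a meromorphic function along an ultrafilter. -/
def germMer (z : ℂ) (𝒰 : Ultrafilter ℂ) : meromorphicSubring z →+* Germ (𝒰 : Filter ℂ) ℂ :=
  (Germ.coeRingHom (𝒰 : Filter ℂ)).comp (meromorphicSubring z).subtype

/-- The field of germs of meromorphic functions along an ultrafilter. -/
def germField (z : ℂ) (𝒰 : Ultrafilter ℂ) : Subfield (Germ (𝒰 : Filter ℂ) ℂ) where
  toSubring := (germMer z 𝒰).range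
  inv_mem' := by
    rintro _ ⟨f, rfl⟩
    exact ⟨⟨f.1⁻¹, MeromorphicAt.inv f.2⟩, rfl⟩

/-- The surjection of the ring of meromorphic functions onto the field of germs. -/
def toGermField (z : ℂ) (𝒰 : Ultrafilter ℂ) : meromorphicSubring z →+* germField z 𝒰 :=
  (germMer z 𝒰).rangeRestrict

lemma toGermField_surjective (𝒰 : Ultrafilter ℂ) : Function.Surjective (toGermField z 𝒰) :=
  (germMer z 𝒰).rangeRestrict_surjective

lemma algebraMap_toGermField (𝒰 : Ultrafilter ℂ) (f : meromorphicSubring z) :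
    algebraMap (germField z 𝒰) (Germ (𝒰 : Filter ℂ) ℂ) (toGermField z 𝒰 f) =
      ((f.1 : ℂ → ℂ) : Germ (𝒰 : Filter ℂ) ℂ) := rfl

lemma charZero_germField (𝒰 : Ultrafilter ℂ) : CharZero (germField z 𝒰) :=
  charZero_of_injective_ringHom
    (f := (toGermField z 𝒰).comp
      ((Pi.constRingHom ℂ ℂ).codRestrict (meromorphicSubring z)
        fun c => MeromorphicAt.const c z)) (RingHom.injective _)

variable {𝒰 : Ultrafilter ℂ}

/-- A meromorphic function vanishes identically or nowhere on a small punctured disc, so vanishing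
along the ultrafilter decides. This turns identities over the field of germs into identities on a
punctured neighbourhood. -/
lemma eventually_eq_zero_of_toGermField (h𝒰 : (𝒰 : Filter ℂ) ≤ 𝓝[≠] z)
    {f : meromorphicSubring z} (hf : toGermField z 𝒰 f = 0) : ∀ᶠ t in 𝓝[≠] z, f.1 t = 0 := by
  have h1 : ((f.1 : ℂ → ℂ) : Germ (𝒰 : Filter ℂ) ℂ) = ((fun _ => 0 : ℂ → ℂ)) := by
    rw [← algebraMap_toGermField, hf, map_zero]; rfl
  have h2 : ∀ᶠ t in (𝒰 : Filter ℂ), f.1 t = 0 := Germ.coe_eq.1 h1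
  rcases MeromorphicAt.eventually_eq_zero_or_eventually_ne_zero f.2 with h | h
  · exact h
  · obtain ⟨t, ht, ht'⟩ := (h2.and (h𝒰 h)).exists
    exact absurd ht ht'

lemma eventually_map_eval_eq_zero (h𝒰 : (𝒰 : Filter ℂ) ≤ 𝓝[≠] z)
    {r : (meromorphicSubring z)[X]} (hr : r.map (toGermField z 𝒰) = 0) :
    ∀ᶠ t in 𝓝[≠] z, r.map (evalMer z t) = 0 := by
  have h1 : ∀ k ∈ r.support, ∀ᶠ t in 𝓝[≠] z, (r.coeff k).1 t = 0 := by
    intro k _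
    refine eventually_eq_zero_of_toGermField h𝒰 ?_
    rw [← coeff_map, hr, coeff_zero]
  filter_upwards [(Filter.eventually_all_finset r.support).2 h1] with t ht
  ext k
  rw [coeff_map, coeff_zero]
  by_cases hk : k ∈ r.support
  · exact ht k hk
  · rw [notMem_support_iff.1 hk, map_zero]

lemma aeval_map_toGermField (g : ℂ → ℂ) (r : (meromorphicSubring z)[X]) :
    aeval ((g : ℂ → ℂ) : Germ (𝒰 : Filter ℂ) ℂ) (r.map (toGermField z 𝒰)) =
      ((fun t => (r.map (evalMer z t)).eval (g t) : ℂ → ℂ) : Germ (𝒰 : Filter ℂ) ℂ) := by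
  induction r using Polynomial.induction_on' with
  | add p q hp hq =>
    simp only [Polynomial.map_add, map_add, eval_add, hp, hq]
    rfl
  | monomial k f =>
    simp only [map_monomial, aeval_monomial, eval_monomial, algebraMap_toGermField]
    rfl

lemma aeval_map_toGermField_eq_zero_iff (g : ℂ → ℂ) (r : (meromorphicSubring z)[X]) :
    aeval ((g : ℂ → ℂ) : Germ (𝒰 : Filter ℂ) ℂ) (r.map (toGermField z 𝒰)) = 0 ↔
      ∀ᶠ t in (𝒰 : Filter ℂ), (r.map (evalMer z t)).eval (g t) = 0 := by
  rw [aeval_map_toGermField]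
  exact Germ.coe_eq

lemma eventually_eventually_punctured {p : ℂ → Prop} (h : ∀ᶠ t in 𝓝[≠] z, p t) :
    ∀ᶠ t in 𝓝[≠] z, ∀ᶠ t' in 𝓝 t, p t' := by
  filter_upwards [eventually_eventually_nhdsWithin.2 h, self_mem_nhdsWithin] with t ht htz
  rwa [isOpen_compl_singleton.nhdsWithin_eq htz] at ht

lemma eventually_analyticAt_coeff (r : (meromorphicSubring z)[X]) :
    ∀ᶠ t in 𝓝[≠] z, ∀ k, AnalyticAt ℂ (r.coeff k).1 t := by
  have h1 : ∀ k ∈ r.support, ∀ᶠ t in 𝓝[≠] z, AnalyticAt ℂ (r.coeff k).1 t :=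
    fun k _ => MeromorphicAt.eventually_analyticAt (r.coeff k).2
  filter_upwards [(Filter.eventually_all_finset r.support).2 h1] with t ht k
  by_cases hk : k ∈ r.support
  · exact ht k hk
  · rw [notMem_support_iff.1 hk]
    exact analyticAt_const

/-- The derivative of the coefficients of a polynomial. -/
def derivCoeffs (r : (meromorphicSubring z)[X]) : (meromorphicSubring z)[X] :=
  ∑ k ∈ r.support, monomial k ⟨deriv (r.coeff k).1, MeromorphicAt.deriv (r.coeff k).2⟩

lemma coeff_derivCoeffs (r : (meromorphicSubring z)[X]) (k : ℕ) :
    ((derivCoeffs r).coeff k).1 = deriv (r.coeff k).1 := by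
  classical
  rw [derivCoeffs, finsetSum_coeff]
  simp only [coeff_monomial, Finset.sum_ite_eq']
  split_ifs with h
  · rfl
  · rw [notMem_support_iff.1 h]
    exact (deriv_const' (0 : ℂ)).symm

lemma hasDerivAt_eval_map {r : (meromorphicSubring z)[X]} {t : ℂ}
    (h : ∀ k, AnalyticAt ℂ (r.coeff k).1 t) (x : ℂ) :
    HasDerivAt (fun t' => (r.map (evalMer z t')).eval x)
      (((derivCoeffs r).map (evalMer z t)).eval x) t := by
  have h1 : ∀ (q : (meromorphicSubring z)[X]) (t' : ℂ), q.support ⊆ r.support →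
      (q.map (evalMer z t')).eval x = ∑ k ∈ r.support, (q.coeff k).1 t' * x ^ k := by
    intro q t' hq
    rw [eval_map, eval₂_eq_sum, Polynomial.sum]
    refine Finset.sum_subset hq fun k _ hk => ?_
    rw [notMem_support_iff.1 hk]; simp
  have h2 : (derivCoeffs r).support ⊆ r.support := by
    intro k hk
    by_contra hk'
    apply mem_support_iff.1 hk
    apply Subtype.ext
    rw [coeff_derivCoeffs, notMem_support_iff.1 hk']
    exact deriv_const' (0 : ℂ)
  rw [h1 _ _ h2]
  simp only [fun t' => h1 r t' subset_rfl, coeff_derivCoeffs]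
  exact HasDerivAt.fun_sum fun k _ => (h k).differentiableAt.hasDerivAt.mul_const _

end MeromorphicFamilies

/-! ### Roots that are stationary to first order at accumulating parameters. -/

section FlatRoots

open Polynomial

variable {z : ℂ}

lemma tendsto_zero_of_pow_mul {ι : Type*} {F : Filter ι} {f g : ι → ℂ} {m : ℕ} {y : ℂ}
    (hy : y ≠ 0) (hg : Tendsto g F (𝓝 y))
    (h : Tendsto (fun t => f t ^ m * g t) F (𝓝 0)) : Tendsto f F (𝓝 0) := by
  have h1 := h.div hg hy
  rw [zero_div] at h1
  have h2 : Tendsto (fun t => f t ^ m) F (𝓝 0) := by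
    refine h1.congr' ((hg.eventually_ne hy).mono fun t ht => ?_)
    rw [Pi.div_apply, mul_div_cancel_right₀ _ ht]
  rcases Nat.eq_zero_or_pos m with rfl | hm
  · simp only [pow_zero] at h2
    rcases F.eq_or_neBot with rfl | hF
    · exact tendsto_bot
    · exact absurd (tendsto_nhds_unique h2 tendsto_const_nhds) (by norm_num)
  · rw [Metric.tendsto_nhds] at h2 ⊢
    intro ε hε
    filter_upwards [h2 (ε ^ m) (by positivity)] with t ht
    rw [dist_zero_right] at ht ⊢
    rw [norm_pow] at ht
    exact lt_of_pow_lt_pow_left₀ m hε.le ht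

lemma rootMultiplicity_pow_mul {f e : ℂ[X]} {x : ℂ} (hf : f.eval x = 0)
    (hf' : f.derivative.eval x ≠ 0) (he : e.eval x ≠ 0) (m : ℕ) :
    (f ^ m * e).rootMultiplicity x = m := by
  have hf0 : f ≠ 0 := fun h => by simp [h] at hf'
  have he0 : e ≠ 0 := fun h => by simp [h] at he
  rw [rootMultiplicity_mul (mul_ne_zero (pow_ne_zero _ hf0) he0), rootMultiplicity_eq_zero he,
    add_zero, ← count_roots, roots_pow, Multiset.count_nsmul, count_roots]
  have h1 : 0 < f.rootMultiplicity x := (rootMultiplicity_pos hf0).2 hf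
  have h2 : ¬ 1 < f.rootMultiplicity x := fun h =>
    hf' ((one_lt_rootMultiplicity_iff_isRoot hf0).1 h).2
  rw [show f.rootMultiplicity x = 1 by omega, mul_one]

/-- A root `g t` of a meromorphic family of monic polynomials which is stationary to first order,
in the sense that `P_{t'}(g t)` vanishes at `t' = t` to an order above the multiplicity of the root,
for parameters `t` accumulating at `z`, is a root of all nearby members of the family. -/
theorem exists_flat_root {P : (meromorphicSubring z)[X]} (hP : P.Monic) {S : Set ℂ}
    (hS : ∃ᶠ t in 𝓝[≠] z, t ∈ S) {g : ℂ → ℂ}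
    (hroot : ∀ t ∈ S, (P.map (evalMer z t)).eval (g t) = 0)
    (hflat : ∀ t ∈ S, Tendsto (fun t' => (P.map (evalMer z t')).eval (g t) /
      (t' - t) ^ ((P.map (evalMer z t)).rootMultiplicity (g t))) (𝓝[≠] t) (𝓝 0)) :
    ∃ t ∈ S, ∀ᶠ t' in 𝓝[≠] z, (P.map (evalMer z t')).eval (g t) = 0 := by
  have hne : NeBot (𝓝[≠] z ⊓ 𝓟 S) := frequently_mem_iff_neBot.1 hS
  set 𝒰 : Ultrafilter ℂ := Ultrafilter.of (𝓝[≠] z ⊓ 𝓟 S)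
  have h𝒰 : (𝒰 : Filter ℂ) ≤ 𝓝[≠] z := (Ultrafilter.of_le _).trans inf_le_left
  have h𝒰S : ∀ᶠ t in (𝒰 : Filter ℂ), t ∈ S :=
    (Ultrafilter.of_le (𝓝[≠] z ⊓ 𝓟 S)).trans inf_le_right (mem_principal_self S)
  have := charZero_germField (z := z) 𝒰
  set K := germField z 𝒰
  set ρ := toGermField z 𝒰
  -- The choice g need not be continuous, let alone meromorphic. Its germ along the ultrafilter is
  -- nevertheless algebraic over the field K of meromorphic germs, so it has a minimal polynomial f.
  set x : Germ (𝒰 : Filter ℂ) ℂ := ((g : ℂ → ℂ) : Germ (𝒰 : Filter ℂ) ℂ)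
  have hPx : aeval x (P.map ρ) = 0 :=
    (aeval_map_toGermField_eq_zero_iff g P).2 (h𝒰S.mono hroot)
  have hint : IsIntegral K x := ⟨P.map ρ, hP.map ρ, hPx⟩
  set f := minpoly K x with hf
  have hfirr : Irreducible f := minpoly.irreducible hint
  have hfin : FiniteMultiplicity f (P.map ρ) :=
    FiniteMultiplicity.of_not_isUnit hfirr.not_isUnit (hP.map ρ).ne_zero
  obtain ⟨e, he, hfe⟩ := hfin.exists_eq_pow_mul_and_not_dvd
  set m := multiplicity f (P.map ρ)
  obtain ⟨ft, hft, hftdeg, hftmon⟩ := lifts_and_natDegree_eq_and_monic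
    ((mem_lifts f).2 (map_surjective ρ (toGermField_surjective 𝒰) f)) (minpoly.monic hint)
  obtain ⟨et, het⟩ := map_surjective ρ (toGermField_surjective 𝒰) e
  have hmpos : m ≠ 0 := by
    intro h0
    apply hfe
    rw [h0, pow_zero, one_mul] at he
    rw [← he]
    exact minpoly.dvd K x hPx
  have hfact : ∀ᶠ t in 𝓝[≠] z, P.map (evalMer z t) =
      (ft.map (evalMer z t)) ^ m * et.map (evalMer z t) := by
    have h0 : (P - ft ^ m * et).map ρ = 0 := by
      rw [Polynomial.map_sub, Polynomial.map_mul, Polynomial.map_pow, hft, het, ← he, sub_self]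
    filter_upwards [eventually_map_eval_eq_zero h𝒰 h0] with t ht
    rwa [Polynomial.map_sub, Polynomial.map_mul, Polynomial.map_pow, sub_eq_zero] at ht
  have hf0 : ∀ᶠ t in (𝒰 : Filter ℂ), (ft.map (evalMer z t)).eval (g t) = 0 := by
    rw [← aeval_map_toGermField_eq_zero_iff]
    change aeval x (ft.map ρ) = 0
    rw [hft]; exact minpoly.aeval K x
  -- In characteristic zero the irreducible f is separable, so `g t` is a simple root of f. As it is
  -- not a root of e, its multiplicity as a root of P is exactly m.
  have hf1 : ∀ᶠ t in (𝒰 : Filter ℂ), (ft.map (evalMer z t)).derivative.eval (g t) ≠ 0 := by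
    have h1 : aeval x (derivative f) ≠ 0 :=
      hfirr.separable.aeval_derivative_ne_zero (minpoly.aeval K x)
    rw [← hft, derivative_map, Ne, aeval_map_toGermField_eq_zero_iff, ← Ultrafilter.eventually_not]
      at h1
    simpa only [derivative_map] using h1
  have he0 : ∀ᶠ t in (𝒰 : Filter ℂ), (et.map (evalMer z t)).eval (g t) ≠ 0 := by
    have h1 : aeval x e ≠ 0 := fun h => hfe (minpoly.dvd K x h)
    rwa [← het, Ne, aeval_map_toGermField_eq_zero_iff, ← Ultrafilter.eventually_not] at h1
  -- Dividing P = f^m e by (t' - t)^m, the flatness hypothesis says that the m-th power of the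
  -- difference quotient of f at the fixed point `g t`, times a factor with nonzero limit, tends to
  -- zero. So the derivative of f in the parameter vanishes there.
  have hderiv : ∀ᶠ t in (𝒰 : Filter ℂ), ((derivCoeffs ft).map (evalMer z t)).eval (g t) = 0 := by
    filter_upwards [h𝒰 (eventually_eventually_punctured hfact), h𝒰S, hf0, hf1, he0,
      h𝒰 (eventually_analyticAt_coeff ft), h𝒰 (eventually_analyticAt_coeff et)]
      with t hft' htS h0 h1 h2 hfa hea
    have hmult : (P.map (evalMer z t)).rootMultiplicity (g t) = m := by
      rw [hft'.self_of_nhds]; exact rootMultiplicity_pow_mul h0 h1 h2 m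
    have hfd := hasDerivAt_eval_map hfa (g t)
    have hec := (hasDerivAt_eval_map hea (g t)).continuousAt.tendsto.mono_left
      (nhdsWithin_le_nhds (s := {t}ᶜ))
    have hlim : Tendsto (fun t' => ((ft.map (evalMer z t')).eval (g t) / (t' - t)) ^ m *
        (et.map (evalMer z t')).eval (g t)) (𝓝[≠] t) (𝓝 0) := by
      refine (hflat t htS).congr' ?_
      filter_upwards [nhdsWithin_le_nhds hft'] with t' ht'
      rw [ht', hmult, eval_mul, eval_pow, div_pow]
      ring
    have hq := tendsto_zero_of_pow_mul h2 hec hlim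
    have hsl := hfd.tendsto_slope
    refine tendsto_nhds_unique hsl (hq.congr fun t' => ?_)
    rw [slope_def_field, h0, sub_zero]
  -- Since f is monic, differentiating its coefficients lowers the degree. The result still
  -- annihilates x, so minimality of f forces it to be zero.
  have hdzero : (derivCoeffs ft).map ρ = 0 := by
    by_contra hd
    have h1 := minpoly.degree_le_of_ne_zero K x hd
      ((aeval_map_toGermField_eq_zero_iff g _).2 hderiv)
    have h2 : ((derivCoeffs ft).map ρ).degree < (ft.map ρ).degree := by
      rw [degree_eq_natDegree (hftmon.map ρ).ne_zero, degree_lt_iff_coeff_zero]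
      intro k hk
      rw [hftmon.natDegree_map] at hk
      rw [coeff_map]
      convert map_zero ρ
      apply Subtype.ext
      rw [coeff_derivCoeffs]
      rcases hk.eq_or_lt with h | h
      · rw [← h, hftmon.coeff_natDegree]
        exact deriv_const' (1 : ℂ)
      · rw [coeff_eq_zero_of_natDegree_lt h]
        exact deriv_const' (0 : ℂ)
    rw [hft] at h2
    exact absurd h1 (not_le.2 h2)
  -- The coefficients of f are constant on a punctured disc, so a root at one parameter is a root at
  -- all of them.
  obtain ⟨r, hr, hball⟩ := Metric.mem_nhdsWithin_iff.1
    ((eventually_map_eval_eq_zero h𝒰 hdzero).and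
      ((eventually_analyticAt_coeff ft).and hfact))
  have hset : Metric.ball z r ∩ {z}ᶜ = Metric.ball z r \ {z} := rfl
  rw [hset] at hball
  have hconst : ∀ t ∈ Metric.ball z r \ {z}, ∀ t' ∈ Metric.ball z r \ {z},
      ft.map (evalMer z t) = ft.map (evalMer z t') := by
    intro t ht t' ht'
    ext k
    rw [coeff_map, coeff_map]
    refine (Metric.isOpen_ball.sdiff isClosed_singleton).is_const_of_deriv_eq_zero
      (isPreconnected_ball_diff_singleton z hr) (f := (ft.coeff k).1)
      (fun w hw => ((hball hw).2.1 k).differentiableAt.differentiableWithinAt)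
      (fun w hw => ?_) ht ht'
    have := congrArg (fun q => q.coeff k) (hball hw).1
    simpa only [coeff_map, evalMer_apply, coeff_derivCoeffs, coeff_zero, Pi.zero_apply] using this
  have hmem : Metric.ball z r \ {z} ∈ 𝓝[≠] z := by
    rw [← hset, Set.inter_comm]
    exact inter_mem_nhdsWithin _ (Metric.ball_mem_nhds z hr)
  have hU : ∀ᶠ t in (𝒰 : Filter ℂ), t ∈ Metric.ball z r \ {z} := h𝒰 hmem
  obtain ⟨t, htS, htball, ht0⟩ := (h𝒰S.and (hU.and hf0)).exists
  refine ⟨t, htS, ?_⟩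
  filter_upwards [hmem] with t' ht'
  rw [(hball ht').2.2, eval_mul, eval_pow, ← hconst t htball t' ht', ht0, zero_pow hmpos, zero_mul]

end FlatRoots

/-! ### The analytic family t ↦ e^{itA} U and its stationary eigenvalues. -/

section DiagonalMaps

open Complex

variable {c : ℕ}

lemma EuclideanSpace.tendsto_iff {ι : Type*} {F : Filter ι} {f : ι → CoinSpace c}
    {y : CoinSpace c} : Tendsto f F (𝓝 y) ↔ ∀ v, Tendsto (fun t => f t v) F (𝓝 (y v)) := by
  rw [(PiLp.continuousLinearEquiv 2 ℂ (fun _ : Fin c => ℂ)).toHomeomorph.isInducing.tendsto_nhds_iff,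
    tendsto_pi_nhds]
  rfl

/-- The diagonal operator with the given entries. -/
def diagMap (w : Fin c → ℂ) : CoinSpace c →ₗ[ℂ] CoinSpace c where
  toFun x := WithLp.toLp 2 fun v => w v * x v
  map_add' x y := by ext v; simp [mul_add]
  map_smul' r x := by ext v; simp; ring

@[simp] lemma diagMap_apply (w : Fin c → ℂ) (x : CoinSpace c) (v : Fin c) :
    diagMap w x v = w v * x v := rfl

/-- The diagonal operator with real entries. -/
abbrev realDiag (a : Fin c → ℝ) : CoinSpace c →ₗ[ℂ] CoinSpace c := diagMap fun v => (a v : ℂ)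

lemma isSymmetric_realDiag (a : Fin c → ℝ) : (realDiag a).IsSymmetric := by
  intro x y
  simp [PiLp.inner_apply]
  refine Finset.sum_congr rfl fun v _ => ?_
  ring

/-- The diagonal isometry with the given phases. -/
def phase (w : Fin c → Circle) : CoinSpace c →ₗᵢ[ℂ] CoinSpace c where
  toLinearMap := diagMap fun v => (w v : ℂ)
  norm_map' x := by
    have h : ∀ v, ‖(w v : ℂ)‖ = 1 := fun v => Circle.norm_coe (w v)
    simp [EuclideanSpace.norm_eq, h]

@[simp] lemma phase_apply (w : Fin c → Circle) (x : CoinSpace c) (v : Fin c) :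
    phase w x v = w v * x v := rfl

lemma phase_mul (w w' : Fin c → Circle) : phase (w * w') = (phase w).comp (phase w') := by
  ext x v
  simp [mul_assoc]

/-- The one-parameter group of phases generated by a real diagonal operator. -/
def phaseExp (a : Fin c → ℝ) (t : ℝ) : CoinSpace c →ₗᵢ[ℂ] CoinSpace c :=
  phase fun v => Circle.exp (a v * t)

lemma toLinearMap_phaseExp (a : Fin c → ℝ) (t : ℝ) :
    (phaseExp a t).toLinearMap = diagMap fun v => exp (I * a v * t) := by
  ext x v
  simp only [phaseExp, LinearIsometry.coe_toLinearMap, phase_apply, diagMap_apply, Circle.coe_exp]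
  congr 2
  push_cast; ring

lemma tendsto_inv_smul_diagMap_sub {ι : Type*} {F : Filter ι} {s : ι → ℂ}
    (hs : Tendsto s F (𝓝[≠] 0)) (a : Fin c → ℝ) (w : CoinSpace c) :
    Tendsto (fun t => (s t)⁻¹ • (diagMap (fun v => exp (I * a v * s t)) w - w)) F
      (𝓝 (I • realDiag a w)) := by
  rw [EuclideanSpace.tendsto_iff]
  intro v
  have h := (tendsto_inv_mul_exp_sub_one hs (I * a v)).mul_const (w v)
  simp only [PiLp.smul_apply, PiLp.sub_apply, diagMap_apply, smul_eq_mul]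
  rw [← mul_assoc]
  exact h.congr fun t => by ring

/-- The family `t ↦ e^{itA} U` as a matrix of entire functions. -/
def kickedMatrix (z : ℂ) (a : Fin c → ℝ) (U : CoinSpace c →ₗ[ℂ] CoinSpace c) :
    Matrix (Fin c) (Fin c) (meromorphicSubring z) :=
  Matrix.of fun v w => ⟨fun t => exp (I * a v * t) *
    LinearMap.toMatrix (EuclideanSpace.basisFun (Fin c) ℂ).toBasis
      (EuclideanSpace.basisFun (Fin c) ℂ).toBasis U v w, by
    refine AnalyticAt.meromorphicAt (Differentiable.analyticAt ?_ z)
    fun_prop⟩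

lemma kickedMatrix_map (z : ℂ) (a : Fin c → ℝ) (U : CoinSpace c →ₗ[ℂ] CoinSpace c) (t : ℂ) :
    (kickedMatrix z a U).map (evalMer z t) =
      LinearMap.toMatrix (EuclideanSpace.basisFun (Fin c) ℂ).toBasis
      (EuclideanSpace.basisFun (Fin c) ℂ).toBasis (diagMap (fun v => exp (I * a v * t)) ∘ₗ U) := by
  ext v w
  simp [kickedMatrix, LinearMap.toMatrix_apply]

lemma charpoly_kickedMatrix_map (z : ℂ) (a : Fin c → ℝ) (U : CoinSpace c →ₗ[ℂ] CoinSpace c)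
    (t : ℂ) : (kickedMatrix z a U).charpoly.map (evalMer z t) =
      (diagMap (fun v => exp (I * a v * t)) ∘ₗ U).charpoly := by
  rw [← Matrix.charpoly_map, kickedMatrix_map, LinearMap.charpoly_toMatrix]

lemma LinearMap.eval_charpoly_eq_det (f : CoinSpace c →ₗ[ℂ] CoinSpace c) (x : ℂ) :
    f.charpoly.eval x = LinearMap.det (x • LinearMap.id - f) := by
  rw [← LinearMap.charpoly_toMatrix f (EuclideanSpace.basisFun (Fin c) ℂ).toBasis,
    Matrix.eval_charpoly, ← LinearMap.det_toMatrix (EuclideanSpace.basisFun (Fin c) ℂ).toBasis]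
  rw [map_sub, map_smul, LinearMap.toMatrix_id, Matrix.smul_one_eq_diagonal, Matrix.scalar_apply]

lemma differentiable_det_sub_kicked (a : Fin c → ℝ) (U : CoinSpace c →ₗ[ℂ] CoinSpace c) (x : ℂ) :
    Differentiable ℂ fun t : ℂ =>
      LinearMap.det (x • LinearMap.id - diagMap (fun v => exp (I * a v * t)) ∘ₗ U) := by
  simp only [← LinearMap.det_toMatrix (EuclideanSpace.basisFun (Fin c) ℂ).toBasis,
    Matrix.det_apply]
  refine Differentiable.fun_sum fun σ _ => Differentiable.const_smul ?_ _
  refine Differentiable.fun_finsetProd fun v _ => ?_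
  simp only [LinearMap.toMatrix_apply]
  simp
  fun_prop

/-- Along almost every point of the line `t ↦ e^{itA} U`, every stationary eigenvalue is an
eigenvalue on the whole line. -/
theorem ae_det_eq_zero_of_stationary (U : CoinSpace c →ₗᵢ[ℂ] CoinSpace c) (a : Fin c → ℝ) :
    ∀ᵐ t : ℝ, ∀ (b : OrthonormalBasis (Fin c) ℂ (CoinSpace c)) (l : Fin c → ℂ) (α : Fin c → ℝ),
      IsAdaptedBasis ((phaseExp a t).comp U) (realDiag a) b l α → ∀ i, α i = 0 → ∀ t' : ℝ,
        LinearMap.det (l i • LinearMap.id - ((phaseExp a t').comp U).toLinearMap) = 0 := by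
  set M : ℂ → CoinSpace c →ₗ[ℂ] CoinSpace c := fun t =>
    diagMap (fun v => exp (I * a v * t)) ∘ₗ U.toLinearMap with hM
  have hMreal : ∀ t : ℝ, ((phaseExp a t).comp U).toLinearMap = M t := by
    intro t
    rw [hM]
    simp only
    rw [← toLinearMap_phaseExp]
    rfl
  rw [ae_iff]
  refine measure_null_of_locally_null _ fun t₀ _ => ?_
  set B := {t : ℝ | ¬ ∀ (b : OrthonormalBasis (Fin c) ℂ (CoinSpace c)) (l : Fin c → ℂ)
    (α : Fin c → ℝ), IsAdaptedBasis ((phaseExp a t).comp U) (realDiag a) b l α → ∀ i, α i = 0 →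
    ∀ t' : ℝ, LinearMap.det (l i • LinearMap.id - ((phaseExp a t').comp U).toLinearMap) = 0}
    with hB
  -- If the bad parameters do not accumulate at t₀, they meet some neighbourhood of t₀ in at most
  -- the point t₀, which is null.
  suffices h : ∀ᶠ t in 𝓝[≠] t₀, t ∉ B by
    refine ⟨B ∩ {t₀}, ?_, measure_mono_null Set.inter_subset_right (measure_singleton t₀)⟩
    rw [mem_nhdsWithin_iff_eventually]
    filter_upwards [eventually_nhdsWithin_iff.1 h] with t ht htB
    refine ⟨htB, ?_⟩
    by_contra hne
    exact ht hne htB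
  by_contra hfreq
  rw [not_eventually] at hfreq
  simp only [not_not] at hfreq
  have hBdata : ∀ t ∈ B, ∃ x : ℂ, (∃ t' : ℝ, LinearMap.det (x • LinearMap.id - M t') ≠ 0) ∧
      ∃ (b : OrthonormalBasis (Fin c) ℂ (CoinSpace c)) (l : Fin c → ℂ) (α : Fin c → ℝ),
        IsAdaptedBasis ((phaseExp a t).comp U) (realDiag a) b l α ∧ ∃ i, α i = 0 ∧ l i = x := by
    intro t ht
    simp only [hB, Set.mem_ofPred_eq] at ht
    push Not at ht
    obtain ⟨b, l, α, h, i, hi, t', ht'⟩ := ht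
    exact ⟨l i, ⟨t', by rwa [hMreal] at ht'⟩, b, l, α, h, i, hi, rfl⟩
  -- An arbitrary selection: for each bad t, a stationary eigenvalue that fails to be an eigenvalue
  -- somewhere on the line.
  choose! g hg1 hg2 using hBdata
  have hS : ∃ᶠ t in 𝓝[≠] (t₀ : ℂ), t ∈ ofReal '' B := by
    have htend : Tendsto ofReal (𝓝[≠] t₀) (𝓝[≠] (t₀ : ℂ)) := by
      refine tendsto_nhdsWithin_iff.2
        ⟨(continuous_ofReal.tendsto t₀).mono_left nhdsWithin_le_nhds, ?_⟩
      filter_upwards [self_mem_nhdsWithin] with t ht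
      simpa using ht
    exact htend.frequently (hfreq.mono fun t ht => ⟨t, ht, rfl⟩)
  obtain ⟨_, ⟨t, htB, rfl⟩, hflat⟩ := exists_flat_root
    (Matrix.charpoly_monic (kickedMatrix (t₀ : ℂ) a U.toLinearMap)) hS
    (g := fun t => g t.re) (by
      rintro _ ⟨t, ht, rfl⟩
      obtain ⟨b, l, α, h, i, hi, hli⟩ := hg2 t ht
      rw [charpoly_kickedMatrix_map, LinearMap.eval_charpoly_eq_det, ofReal_re, ← hli]
      change LinearMap.det (l i • LinearMap.id - M t) = 0
      rw [← hMreal]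
      by_contra hdet
      have := LinearMap.ker_eq_bot_of_injective
        (LinearMap.equivOfDetNeZero _ hdet).injective
      have h1 : b i ∈ LinearMap.ker (LinearMap.equivOfDetNeZero _ hdet).toLinearMap := by
        rw [LinearMap.mem_ker]
        change l i • b i - ((phaseExp a t).comp U) (b i) = 0
        rw [h.apply_eq, sub_self]
      rw [this, Submodule.mem_bot] at h1
      exact b.toBasis.ne_zero i (by simpa using h1)) (by
      rintro _ ⟨t, ht, rfl⟩
      obtain ⟨b, l, α, h, i, hi, hli⟩ := hg2 t ht
      have hs : Tendsto (fun t' : ℂ => t' - t) (𝓝[≠] (t : ℂ)) (𝓝[≠] 0) := by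
        refine tendsto_nhdsWithin_iff.2 ⟨?_, ?_⟩
        · have : Continuous fun t' : ℂ => t' - t := by fun_prop
          simpa using (this.tendsto (t : ℂ)).mono_left nhdsWithin_le_nhds
        · filter_upwards [self_mem_nhdsWithin] with t' ht'
          exact sub_ne_zero.2 ht'
      have h1 := h.tendsto_det_div hs (tendsto_inv_smul_diagMap_sub hs a) hi
      have h2 := h.rootMultiplicity_charpoly (l i)
      simp only [charpoly_kickedMatrix_map, LinearMap.eval_charpoly_eq_det, ofReal_re, ← hli]
      change Tendsto (fun t' => LinearMap.det (l i • LinearMap.id - M t') /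
        (t' - t) ^ (M t).charpoly.rootMultiplicity (l i)) _ _
      rw [← hMreal, h2]
      refine h1.congr fun t' => ?_
      congr 3
      rw [hMreal]
      ext x v
      simp only [hM, LinearMap.comp_apply, diagMap_apply]
      rw [← mul_assoc, ← exp_add]
      congr 2
      ring)
  -- The determinant at the fixed value `g t` is entire in the parameter and vanishes near t₀. It
  -- therefore vanishes identically, against the choice of `g t`.
  obtain ⟨t', ht'⟩ := hg1 t htB
  apply ht'
  have hd := differentiable_det_sub_kicked a U.toLinearMap (g t)
  have hfreq0 : ∃ᶠ w in 𝓝[≠] (t₀ : ℂ), LinearMap.det (g t • LinearMap.id - M w) = 0 := by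
    refine (hflat.mono fun w hw => ?_).frequently
    rwa [charpoly_kickedMatrix_map, LinearMap.eval_charpoly_eq_det, ofReal_re] at hw
  exact congrFun (AnalyticOnNhd.eq_of_frequently_eq (f := fun w => LinearMap.det
    (g t • LinearMap.id - M w)) (g := fun _ => 0) (fun w _ => hd.analyticAt w)
    (fun w _ => analyticAt_const) hfreq0) (t' : ℂ)

end DiagonalMaps

/-! ### Characters of the torus and Parseval's identity. -/

section Torus

variable {d : ℕ}

/-- The torus `(ℝ/ℤ)^d`. -/
abbrev Torus (d : ℕ) := Fin d → UnitAddCircle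

instance isProbabilityMeasure_unitAddCircle :
    IsProbabilityMeasure (volume : Measure UnitAddCircle) :=
  ⟨UnitAddCircle.measure_univ⟩

/-- The character of the torus with frequency `m`. -/
def torusChar (m : Fin d → ℤ) (z : Torus d) : Circle := ∏ i, (z i).toCircle ^ m i

/-- The point of the torus with the given coordinates. -/
def torusMk (y : Fin d → ℝ) : Torus d := fun i => (y i : UnitAddCircle)

lemma torusMk_surjective : Function.Surjective (torusMk (d := d)) := by
  intro z
  choose y hy using fun i => QuotientAddGroup.mk_surjective (z i)
  exact ⟨y, funext hy⟩

lemma torusChar_zero (z : Torus d) : torusChar 0 z = 1 := by simp [torusChar]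

lemma torusChar_add (m n : Fin d → ℤ) (z : Torus d) :
    torusChar (m + n) z = torusChar m z * torusChar n z := by
  simp [torusChar, zpow_add, Finset.prod_mul_distrib]

lemma torusChar_neg (m : Fin d → ℤ) (z : Torus d) : torusChar (-m) z = (torusChar m z)⁻¹ := by
  simp [torusChar]

lemma torusChar_nsmul (k : ℕ) (m : Fin d → ℤ) (z : Torus d) :
    torusChar (k • m) z = torusChar m z ^ k := by
  simp only [torusChar, Pi.smul_apply, ← Finset.prod_pow]
  refine Finset.prod_congr rfl fun i _ => ?_
  rw [nsmul_eq_mul, mul_comm, zpow_mul, zpow_natCast]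

lemma torusChar_apply_add (m : Fin d → ℤ) (z w : Torus d) :
    torusChar m (z + w) = torusChar m z * torusChar m w := by
  simp [torusChar, AddCircle.toCircle_add, mul_zpow, Finset.prod_mul_distrib]

lemma torusChar_apply_zero (m : Fin d → ℤ) : torusChar m 0 = 1 := by
  simp [torusChar]

lemma torusChar_mk (m : Fin d → ℤ) (y : Fin d → ℝ) :
    torusChar m (torusMk y) = Circle.exp (2 * Real.pi * ∑ i, m i * y i) := by
  rw [Finset.mul_sum]
  have h : ∀ i, (torusMk y i).toCircle ^ m i = Circle.exp (2 * Real.pi * (m i * y i)) := by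
    intro i
    rw [torusMk, AddCircle.toCircle_apply_mk, ← Circle.exp_zsmul]
    congr 1
    simp; ring
  simp only [torusChar, h]
  induction (Finset.univ : Finset (Fin d)) using Finset.induction_on with
  | empty => simp
  | insert i s hi ih => rw [Finset.prod_insert hi, Finset.sum_insert hi, Circle.exp_add, ih]

@[fun_prop]
lemma continuous_torusChar (m : Fin d → ℤ) : Continuous (torusChar m) := by
  unfold torusChar
  refine continuous_finsetProd _ fun i _ => ?_
  exact (AddCircle.continuous_toCircle.comp (continuous_apply i)).zpow (m i)

lemma integral_torusChar (m : Fin d → ℤ) :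
    ∫ z, (torusChar m z : ℂ) = if m = 0 then 1 else 0 := by
  split_ifs with h
  · subst h
    simp [torusChar_zero]
  · obtain ⟨i, hi⟩ := Function.ne_iff.1 h
    have hi' : (m i : ℝ) ≠ 0 := by exact_mod_cast hi
    -- Translation by w multiplies the character by -1, so the integral equals its own negative.
    let w : Torus d := torusMk (Pi.single i (1 / (2 * m i)))
    have hw : torusChar m w = Circle.exp Real.pi := by
      rw [torusChar_mk]
      congr 1
      rw [Finset.sum_eq_single i]
      · simp; field_simp
      · intro j _ hj; simp [hj]
      · simp
    have h1 : ∫ z, (torusChar m (z + w) : ℂ) = ∫ z, (torusChar m z : ℂ) :=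
      integral_add_right_eq_self (fun z => (torusChar m z : ℂ)) w
    simp only [torusChar_apply_add, Circle.coe_mul, hw, Circle.coe_exp, Complex.exp_pi_mul_I,
      mul_neg, mul_one, integral_neg] at h1
    have h2 : (2 : ℂ) * ∫ z, (torusChar m z : ℂ) = 0 := by linear_combination -h1
    simpa using h2

lemma integrable_of_continuous_torus {F : Type*} [NormedAddCommGroup F] {f : Torus d → F}
    (hf : Continuous f) : Integrable f :=
  hf.integrable_of_hasCompactSupport (HasCompactSupport.of_compactSpace f)

variable {E : Type*} [NormedAddCommGroup E] [InnerProductSpace ℂ E]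

/-- Parseval's identity for trigonometric polynomials. -/
lemma integral_inner_trigPoly (F : Finset (Fin d → ℤ)) (f g : (Fin d → ℤ) → E) :
    ∫ z, inner ℂ (∑ x ∈ F, (torusChar x z : ℂ) • f x) (∑ x ∈ F, (torusChar x z : ℂ) • g x) =
      ∑ x ∈ F, inner ℂ (f x) (g x) := by
  have h1 : ∀ z, inner ℂ (∑ x ∈ F, (torusChar x z : ℂ) • f x) (∑ x ∈ F, (torusChar x z : ℂ) • g x)
      = ∑ x ∈ F, ∑ y ∈ F, (torusChar (y - x) z : ℂ) * inner ℂ (f x) (g y) := by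
    intro z
    rw [sum_inner]
    refine Finset.sum_congr rfl fun x _ => ?_
    rw [inner_sum]
    refine Finset.sum_congr rfl fun y _ => ?_
    rw [inner_smul_left, inner_smul_right, sub_eq_add_neg, torusChar_add, torusChar_neg,
      Circle.coe_mul, Circle.coe_inv_eq_conj]
    ring
  have hint : ∀ x y, Integrable fun z : Torus d =>
      (torusChar (y - x) z : ℂ) * inner ℂ (f x) (g y) := fun x y =>
    integrable_of_continuous_torus (by fun_prop)
  simp only [h1]
  rw [integral_finsetSum _ fun x _ => integrable_finsetSum _ fun y _ => hint x y]
  refine Finset.sum_congr rfl fun x hx => ?_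
  rw [integral_finsetSum _ fun y _ => hint x y]
  simp only [integral_mul_const, integral_torusChar, sub_eq_zero]
  simp [hx]

end Torus

/-! ### The walk in the momentum representation. -/

namespace QRW

variable {d c : ℕ}

/-- The wave function at time `T` of the walk started at `0 ⊗ u`. -/
def waveFun (W : QRW d c) (u : CoinSpace c) (T : ℕ) : WalkSpace d c := (W.step ^ T) (ket 0 u)

lemma waveFun_zero (W : QRW d c) (u : CoinSpace c) (x : Fin d → ℤ) :
    W.waveFun u 0 x = if x = 0 then u else 0 := by
  classical
  change (ket 0 u : WalkSpace d c) x = _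
  rw [ket, lp.coeFn_single]
  split_ifs with h
  · subst h; simp
  · simp [h]

lemma waveFun_succ_apply (W : QRW d c) (u : CoinSpace c) (T : ℕ) (x : Fin d → ℤ) (v : Fin c) :
    W.waveFun u (T + 1) x v = W.coin (W.waveFun u T (x - W.jump v)) v := by
  unfold waveFun
  rw [pow_succ']
  rfl

lemma amplitude_eq (W : QRW d c) (u : CoinSpace c) (T : ℕ) (x : Fin d → ℤ) (v : Fin c) :
    W.amplitude u T x v = W.waveFun u T x v := by
  simp [amplitude, ket, lp.inner_single_left, EuclideanSpace.inner_single_left, waveFun]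

lemma siteProb_eq (W : QRW d c) (u : CoinSpace c) (T : ℕ) (x : Fin d → ℤ) :
    W.siteProb u T x = ‖W.waveFun u T x‖ ^ 2 := by
  simp [siteProb, prob, amplitude_eq, EuclideanSpace.norm_sq_eq]

/-- The sites which can be reached in `T` steps. -/
def reach (W : QRW d c) : ℕ → Finset (Fin d → ℤ)
  | 0 => {0}
  | T + 1 => (W.reach T ×ˢ Finset.univ).image fun p => p.1 + W.jump p.2

lemma waveFun_eq_zero (W : QRW d c) (u : CoinSpace c) (T : ℕ) {x : Fin d → ℤ}
    (hx : x ∉ W.reach T) : W.waveFun u T x = 0 := by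
  induction T generalizing x with
  | zero =>
    rw [waveFun_zero, if_neg]
    simpa [reach] using hx
  | succ T ih =>
    ext v
    rw [waveFun_succ_apply, ih, map_zero]
    intro h
    apply hx
    rw [reach, Finset.mem_image]
    exact ⟨(x - W.jump v, v), by simp [h], by simp⟩

/-- The evolution operator in the momentum representation. -/
def symbol (W : QRW d c) (z : Torus d) : CoinSpace c →ₗᵢ[ℂ] CoinSpace c :=
  (phase fun v => torusChar (W.jump v) z).comp W.coin.toLinearIsometry

lemma symbol_apply (W : QRW d c) (z : Torus d) (x : CoinSpace c) (v : Fin c) :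
    W.symbol z x v = torusChar (W.jump v) z * W.coin x v := rfl

/-- A shift of the momentum is a diagonal kick. This turns the characteristic function into a
perturbation problem at a fixed momentum. -/
lemma symbol_add (W : QRW d c) (z w : Torus d) :
    W.symbol (z + w) = (phase fun v => torusChar (W.jump v) w).comp (W.symbol z) := by
  ext x v
  simp only [symbol_apply, LinearIsometry.coe_comp, Function.comp_apply, phase_apply,
    torusChar_apply_add, Circle.coe_mul]
  ring

lemma continuous_symbol_pow_apply (W : QRW d c) (u : CoinSpace c) (T : ℕ) :
    Continuous fun z => ((W.symbol z) ^ T) u := by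
  induction T with
  | zero => exact continuous_const
  | succ T ih =>
    rw [continuous_iff_continuousAt]
    intro z
    rw [ContinuousAt, EuclideanSpace.tendsto_iff]
    intro v
    have h : ∀ z, ((W.symbol z) ^ (T + 1)) u v =
        torusChar (W.jump v) z * W.coin (((W.symbol z) ^ T) u) v := by
      intro z
      rw [pow_succ']
      rfl
    simp only [h]
    have hc : Continuous fun z : Torus d =>
        (torusChar (W.jump v) z : ℂ) * W.coin (((W.symbol z) ^ T) u) v := by
      have h1 : Continuous fun z => W.coin (((W.symbol z) ^ T) u) :=
        W.coin.continuous.comp ih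
      have h2 : Continuous fun z => W.coin (((W.symbol z) ^ T) u) v :=
        (EuclideanSpace.proj (𝕜 := ℂ) v).continuous.comp h1
      fun_prop
    exact hc.tendsto z

/-- The Fourier transform turns translation of the layer v by `jump v` into multiplication by a
character, so each step of the walk applies `symbol` once. -/
lemma hasSum_waveFun (W : QRW d c) (u : CoinSpace c) (T : ℕ) (z : Torus d) :
    HasSum (fun x => (torusChar x z : ℂ) • W.waveFun u T x) (((W.symbol z) ^ T) u) := by
  induction T with
  | zero =>
    have h := hasSum_ite_eq (0 : Fin d → ℤ) u
    refine h.congr_fun fun x => ?_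
    rw [waveFun_zero]
    split_ifs with hx
    · subst hx; simp [torusChar_zero]
    · simp
  | succ T ih =>
    have hco : ∀ v, HasSum (fun x => ((torusChar x z : ℂ) • W.waveFun u (T + 1) x) v)
        (((W.symbol z) ^ (T + 1)) u v) := by
      intro v
      have h1 : HasSum (fun x => (torusChar x z : ℂ) * W.coin (W.waveFun u T x) v)
          (W.coin (((W.symbol z) ^ T) u) v) := by
        have := (((EuclideanSpace.proj (𝕜 := ℂ) v).comp
          W.coin.toContinuousLinearEquiv.toContinuousLinearMap).hasSum ih)
        simpa using this
      have h2 := ((Equiv.subRight (W.jump v)).hasSum_iff.2 h1).mul_left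
        (torusChar (W.jump v) z : ℂ)
      have h3 : ((W.symbol z) ^ (T + 1)) u v =
          torusChar (W.jump v) z * W.coin (((W.symbol z) ^ T) u) v := by
        rw [pow_succ']
        rfl
      rw [h3]
      refine h2.congr_fun fun x => ?_
      simp only [PiLp.smul_apply, smul_eq_mul, waveFun_succ_apply, Function.comp_apply,
        Equiv.subRight_apply]
      rw [← mul_assoc, ← Circle.coe_mul, ← torusChar_add, add_sub_cancel]
    rw [HasSum, EuclideanSpace.tendsto_iff]
    intro v
    have := hco v
    rw [HasSum] at this
    simpa using this

lemma symbol_pow_apply_eq_sum (W : QRW d c) (u : CoinSpace c) (T : ℕ) (z : Torus d)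
    {F : Finset (Fin d → ℤ)} (hF : W.reach T ⊆ F) :
    ((W.symbol z) ^ T) u = ∑ x ∈ F, (torusChar x z : ℂ) • W.waveFun u T x := by
  refine (W.hasSum_waveFun u T z).unique (hasSum_sum_of_ne_finset_zero fun x hx => ?_)
  rw [W.waveFun_eq_zero u T (fun h => hx (hF h)), smul_zero]

/-- The expectation of the modulus squared of a trigonometric polynomial in the position. -/
lemma sum_siteProb_trigPoly (W : QRW d c) (u : CoinSpace c) (T : ℕ) {ι : Type*} (N : Finset ι)
    (w : ι → ℂ) (y : ι → Torus d) :
    ∑ x ∈ W.reach T, ‖∑ n ∈ N, w n * torusChar x (y n)‖ ^ 2 * W.siteProb u T x =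
      ∫ z, ‖∑ n ∈ N, w n • ((W.symbol (z + y n)) ^ T) u‖ ^ 2 := by
  set f : (Fin d → ℤ) → CoinSpace c :=
    fun x => (∑ n ∈ N, w n * torusChar x (y n)) • W.waveFun u T x with hf
  have h1 : ∀ z, ∑ n ∈ N, w n • ((W.symbol (z + y n)) ^ T) u =
      ∑ x ∈ W.reach T, (torusChar x z : ℂ) • f x := by
    intro z
    simp only [W.symbol_pow_apply_eq_sum u T _ subset_rfl, Finset.smul_sum]
    rw [Finset.sum_comm]
    refine Finset.sum_congr rfl fun x _ => ?_
    rw [hf]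
    simp only [Finset.sum_smul, Finset.smul_sum, smul_smul, torusChar_apply_add, Circle.coe_mul]
    refine Finset.sum_congr rfl fun n _ => ?_
    congr 1; ring
  have h2 := integral_inner_trigPoly (W.reach T) f f
  simp only [← h1] at h2
  have h3 : ∀ x : CoinSpace c, inner ℂ x x = ((‖x‖ ^ 2 : ℝ) : ℂ) := fun x => by
    rw [inner_self_eq_norm_sq_to_K]; norm_cast
  simp only [h3] at h2
  rw [integral_complex_ofReal, ← Complex.ofReal_sum] at h2
  rw [Complex.ofReal_inj.1 h2]
  refine Finset.sum_congr rfl fun x _ => ?_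
  rw [hf, norm_smul, mul_pow, siteProb_eq]

/-- The characteristic function of the position. -/
lemma sum_siteProb_char (W : QRW d c) (u : CoinSpace c) (T : ℕ) (y : Torus d) :
    ∑ x ∈ W.reach T, (torusChar x y : ℂ) * W.siteProb u T x =
      ∫ z, inner ℂ (((W.symbol z) ^ T) u) (((W.symbol (z + y)) ^ T) u) := by
  have h1 : ∀ z, ((W.symbol (z + y)) ^ T) u =
      ∑ x ∈ W.reach T, (torusChar x z : ℂ) • ((torusChar x y : ℂ) • W.waveFun u T x) := by
    intro z
    rw [W.symbol_pow_apply_eq_sum u T _ subset_rfl]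
    refine Finset.sum_congr rfl fun x _ => ?_
    rw [torusChar_apply_add, Circle.coe_mul, smul_smul]
  simp only [h1, W.symbol_pow_apply_eq_sum u T _ subset_rfl]
  rw [integral_inner_trigPoly]
  refine Finset.sum_congr rfl fun x _ => ?_
  rw [inner_smul_right, siteProb_eq, inner_self_eq_norm_sq_to_K]
  norm_cast

/-- The amplitude of the initial coin state at a given site. -/
lemma inner_waveFun (W : QRW d c) (u : CoinSpace c) (T : ℕ) (m : Fin d → ℤ) :
    inner ℂ u (W.waveFun u T m) =
      ∫ z, inner ℂ ((torusChar m z : ℂ) • u) (((W.symbol z) ^ T) u) := by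
  classical
  set F := insert m (W.reach T)
  have h := integral_inner_trigPoly F (fun x => if x = m then u else 0) (fun x => W.waveFun u T x)
  simp only [← W.symbol_pow_apply_eq_sum u T _ (Finset.subset_insert m (W.reach T)), F] at h
  simp only [smul_ite, smul_zero, Finset.sum_ite_eq', Finset.mem_insert_self, if_true] at h
  rw [h, Finset.sum_eq_single m]
  · simp
  · intro x _ hx; simp [hx]
  · intro hm; exact absurd (Finset.mem_insert_self _ _) hm

end QRW

namespace QRW

variable {d c : ℕ}

/-! ### The rescaled laws -/

lemma rescaledMeasure_eq_sum (W : QRW d c) (u : CoinSpace c) (T : ℕ) :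
    W.rescaledMeasure u T = ∑ x ∈ W.reach T,
      ENNReal.ofReal (W.siteProb u T x) • Measure.dirac ((T : ℝ)⁻¹ • latticePoint x) := by
  ext s hs
  rw [rescaledMeasure, Measure.sum_apply _ hs, Measure.finsetSum_apply]
  refine tsum_eq_sum fun x hx => ?_
  rw [siteProb_eq, W.waveFun_eq_zero u T hx]
  simp

lemma siteProb_nonneg (W : QRW d c) (u : CoinSpace c) (T : ℕ) (x : Fin d → ℤ) :
    0 ≤ W.siteProb u T x := by
  rw [siteProb_eq]; positivity

lemma integral_rescaledMeasure (W : QRW d c) (u : CoinSpace c) (T : ℕ) {F : Type*}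
    [NormedAddCommGroup F] [NormedSpace ℝ F] [CompleteSpace F]
    (f : EuclideanSpace ℝ (Fin d) → F) :
    ∫ x, f x ∂(W.rescaledMeasure u T) =
      ∑ x ∈ W.reach T, W.siteProb u T x • f ((T : ℝ)⁻¹ • latticePoint x) := by
  rw [rescaledMeasure_eq_sum, integral_finsetSum_measure]
  · refine Finset.sum_congr rfl fun x _ => ?_
    rw [integral_smul_measure, integral_dirac, ENNReal.toReal_ofReal (W.siteProb_nonneg u T x)]
  · intro x _
    refine Integrable.smul_measure ?_ ENNReal.ofReal_ne_top
    exact integrable_dirac (by simp)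

lemma isCompact_jumpHull (W : QRW d c) : IsCompact W.jumpHull :=
  (Set.finite_range _).isCompact_convexHull ℝ

lemma latticePoint_add (x y : Fin d → ℤ) :
    latticePoint (x + y) = latticePoint x + latticePoint y := by
  ext i; simp [latticePoint]

open scoped Pointwise in
lemma latticePoint_mem_smul_jumpHull (W : QRW d c) (T : ℕ) {x : Fin d → ℤ}
    (hx : x ∈ W.reach (T + 1)) : latticePoint x ∈ ((T + 1 : ℕ) : ℝ) • W.jumpHull := by
  have hconv : Convex ℝ W.jumpHull := convex_convexHull ℝ _
  have hv : ∀ v, latticePoint (W.jump v) ∈ W.jumpHull := fun v =>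
    subset_convexHull ℝ _ ⟨v, rfl⟩
  induction T generalizing x with
  | zero =>
    simp only [reach, Finset.mem_image, Finset.mem_product, Finset.mem_singleton,
      Finset.mem_univ, and_true, Prod.exists] at hx
    obtain ⟨p, v, rfl, rfl⟩ := hx
    simpa using hv v
  | succ T ih =>
    rw [reach, Finset.mem_image] at hx
    obtain ⟨⟨p, v⟩, hp, rfl⟩ := hx
    rw [Nat.cast_succ, hconv.add_smul (by positivity) zero_le_one, one_smul, latticePoint_add]
    exact Set.add_mem_add (ih (Finset.mem_product.1 hp).1) (hv v)

lemma inv_smul_latticePoint_mem_jumpHull (W : QRW d c) {T : ℕ} (hT : T ≠ 0) {x : Fin d → ℤ}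
    (hx : x ∈ W.reach T) : (T : ℝ)⁻¹ • latticePoint x ∈ W.jumpHull := by
  obtain ⟨T, rfl⟩ := Nat.exists_eq_succ_of_ne_zero hT
  have h := W.latticePoint_mem_smul_jumpHull T hx
  rwa [Set.mem_smul_set_iff_inv_smul_mem₀ (by positivity)] at h

lemma rescaledMeasure_compl_eq_zero (W : QRW d c) (u : CoinSpace c) (T : ℕ)
    {K : Set (EuclideanSpace ℝ (Fin d))} (hK : MeasurableSet K)
    (h : ∀ x ∈ W.reach T, (T : ℝ)⁻¹ • latticePoint x ∈ K) :
    W.rescaledMeasure u T Kᶜ = 0 := by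
  rw [rescaledMeasure_eq_sum, Measure.finsetSum_apply]
  refine Finset.sum_eq_zero fun x hx => ?_
  rw [Measure.smul_apply, Measure.dirac_apply' _ hK.compl, Set.indicator_of_notMem, smul_zero]
  simpa using h x hx

lemma isTightMeasureSet_rescaledLaw (W : QRW d c) (u : CoinSpace c) (hu : ‖u‖ = 1) :
    IsTightMeasureSet {((μ : ProbabilityMeasure (EuclideanSpace ℝ (Fin d))) :
      Measure (EuclideanSpace ℝ (Fin d))) | μ ∈ Set.range (W.rescaledLaw u hu)} := by
  rw [isTightMeasureSet_iff_exists_isCompact_measure_compl_le]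
  intro ε _
  -- The point 0 accounts for T = 0, where the rescaled position is 0 and need not lie in the hull.
  refine ⟨W.jumpHull ∪ {0}, W.isCompact_jumpHull.union isCompact_singleton, ?_⟩
  rintro _ ⟨_, ⟨T, rfl⟩, rfl⟩
  refine le_of_eq_of_le ?_ zero_le
  refine W.rescaledMeasure_compl_eq_zero u T
    (W.isCompact_jumpHull.union isCompact_singleton).measurableSet fun x hx => ?_
  by_cases hT : T = 0
  · subst hT; simp
  · exact Or.inl (W.inv_smul_latticePoint_mem_jumpHull hT hx)

lemma continuous_charFun (ξ : EuclideanSpace ℝ (Fin d)) :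
    Continuous fun μ : ProbabilityMeasure (EuclideanSpace ℝ (Fin d)) =>
      charFun (μ : Measure (EuclideanSpace ℝ (Fin d))) ξ := by
  rw [continuous_iff_continuousAt]
  intro μ
  have h := (ProbabilityMeasure.tendsto_iff_forall_integral_rclike_tendsto ℂ).1
    (tendsto_id (x := 𝓝 μ))
  simp only [ContinuousAt, charFun_eq_integral_innerProbChar]
  exact h _

/-- Tightness and convergence of the characteristic functions give a weak limit. -/
lemma exists_isLimitMeasure_of_charFun (W : QRW d c) (u : CoinSpace c) (hu : ‖u‖ = 1)
    (h : ∀ ξ, ∃ y, Tendsto (fun T => charFun (W.rescaledMeasure u T) ξ) atTop (𝓝 y)) :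
    ∃ μ, W.IsLimitMeasure u hu μ := by
  choose φ hφ using h
  have hK := isCompact_closure_of_isTightMeasureSet (W.isTightMeasureSet_rescaledLaw u hu)
  have hmem : ∀ T, W.rescaledLaw u hu T ∈ closure (Set.range (W.rescaledLaw u hu)) := fun T =>
    subset_closure ⟨T, rfl⟩
  -- Every cluster point has characteristic function φ, so there is only one. In a compact set this
  -- gives convergence.
  have hcl : ∀ μ, MapClusterPt μ atTop (W.rescaledLaw u hu) → ∀ ξ,
      charFun (μ : Measure (EuclideanSpace ℝ (Fin d))) ξ = φ ξ := by
    intro μ hμ ξ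
    have h1 := hμ.continuousAt_comp (continuous_charFun ξ).continuousAt
    have h2 : ClusterPt (charFun (μ : Measure (EuclideanSpace ℝ (Fin d))) ξ) (𝓝 (φ ξ)) :=
      ClusterPt.mono h1 (hφ ξ)
    exact eq_of_nhds_neBot h2
  obtain ⟨μ, -, hμ⟩ := hK.exists_mapClusterPt (u := W.rescaledLaw u hu) (f := atTop)
    (tendsto_principal.2 (Eventually.of_forall hmem))
  refine ⟨μ, hK.tendsto_nhds_of_unique_mapClusterPt (Eventually.of_forall hmem) ?_⟩
  intro ν _ hν
  have h1 : (ν : Measure (EuclideanSpace ℝ (Fin d))) = μ :=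
    Measure.ext_of_charFun (funext fun ξ => by rw [hcl μ hμ ξ, hcl ν hν ξ])
  exact Subtype.ext h1

/-! ### Atoms and support of the limit -/

lemma mem_jumpHull_of_isAtom (W : QRW d c) {u : CoinSpace c} {hu : ‖u‖ = 1}
    {μ : ProbabilityMeasure (EuclideanSpace ℝ (Fin d))} (hμ : W.IsLimitMeasure u hu μ)
    {s : EuclideanSpace ℝ (Fin d)} (hs : IsAtom μ s) : s ∈ W.jumpHull := by
  by_contra hsn
  have hclosed := W.isCompact_jumpHull.isClosed
  have h1 := ProbabilityMeasure.le_liminf_measure_open_of_tendsto hμ hclosed.isOpen_compl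
  have h2 : ∀ᶠ T in atTop,
      (W.rescaledLaw u hu T : Measure (EuclideanSpace ℝ (Fin d))) W.jumpHullᶜ = 0 := by
    filter_upwards [eventually_ne_atTop 0] with T hT
    exact W.rescaledMeasure_compl_eq_zero u T hclosed.measurableSet fun x hx =>
      W.inv_smul_latticePoint_mem_jumpHull hT hx
  rw [liminf_congr h2, liminf_const] at h1
  have h3 : (μ : Measure (EuclideanSpace ℝ (Fin d))) {s} ≤ 0 :=
    (measure_mono (Set.singleton_subset_iff.2 hsn)).trans h1
  exact absurd hs (not_lt.2 h3)

lemma prob_nonneg (W : QRW d c) (u : CoinSpace c) (T : ℕ) (x : Fin d → ℤ) (v : Fin c) :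
    0 ≤ W.prob u T x v := sq_nonneg _

lemma prob_le_one (W : QRW d c) {u : CoinSpace c} (hu : ‖u‖ = 1) (T : ℕ) (x : Fin d → ℤ)
    (v : Fin c) : W.prob u T x v ≤ 1 :=
  (Finset.single_le_sum (f := W.prob u T x) (fun w _ => W.prob_nonneg u T x w)
    (Finset.mem_univ v)).trans
    (le_hasSum (W.hasSum_siteProb hu T) x fun y _ => W.siteProb_nonneg u T y)

/-- Every closed ball around s has mass at least some fixed ε at all late times `T n`. The
portmanteau theorem for closed sets passes this bound to the limit, and shrinking the balls leaves
mass at least ε at s. -/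
lemma isAtom_of_stronglyLocalizesAt (W : QRW d c) {u : CoinSpace c} {hu : ‖u‖ = 1}
    {μ : ProbabilityMeasure (EuclideanSpace ℝ (Fin d))} (hμ : W.IsLimitMeasure u hu μ)
    {s : EuclideanSpace ℝ (Fin d)} (hs : W.StronglyLocalizesAt u s) : IsAtom μ s := by
  obtain ⟨-, T, k, v, hT, hlim, hk⟩ := hs
  obtain ⟨ε, hε, hε'⟩ := exists_between hlim
  have hev : ∀ᶠ n in atTop, ε < W.prob u (T n) (k n) (v n) :=
    eventually_lt_of_lt_liminf hε'
      (isBoundedUnder_of ⟨0, fun n => W.prob_nonneg u _ _ _⟩)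
  have hball : ∀ r : ℝ, 0 < r → ENNReal.ofReal ε ≤
      (μ : Measure (EuclideanSpace ℝ (Fin d))) (Metric.closedBall s r) := by
    intro r hr
    have h1 := ProbabilityMeasure.limsup_measure_closed_le_of_tendsto (hμ.comp hT)
      (Metric.isClosed_closedBall (x := s) (ε := r))
    refine le_trans ?_ h1
    refine le_limsup_of_le (by isBoundedDefault) fun b hb => ?_
    obtain ⟨n, hn, hp, hd⟩ := (hb.and (hev.and (hk.eventually
      (Metric.closedBall_mem_nhds s hr)))).exists
    refine le_trans ?_ hn
    change _ ≤ W.rescaledMeasure u (T n) (Metric.closedBall s r)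
    rw [rescaledMeasure, Measure.sum_apply _ Metric.isClosed_closedBall.measurableSet]
    refine le_trans ?_ (ENNReal.le_tsum (k n))
    rw [Measure.smul_apply, Measure.dirac_apply' _ Metric.isClosed_closedBall.measurableSet,
      Set.indicator_of_mem (Metric.mem_closedBall.2 hd), Pi.one_apply, smul_eq_mul, mul_one]
    refine ENNReal.ofReal_le_ofReal (hp.le.trans ?_)
    exact Finset.single_le_sum (f := W.prob u (T n) (k n))
      (fun w _ => W.prob_nonneg u _ _ w) (Finset.mem_univ (v n))
  have hinter : (⋂ n : ℕ, Metric.closedBall s (1 / ((n : ℝ) + 1))) = {s} := by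
    ext x
    simp only [Set.mem_iInter, Metric.mem_closedBall, Set.mem_singleton_iff]
    constructor
    · intro h
      exact dist_le_zero.1 (ge_of_tendsto' tendsto_one_div_add_atTop_nhds_zero_nat h)
    · rintro rfl n
      rw [dist_self]; positivity
  have hlim2 := tendsto_measure_iInter_atTop
    (μ := (μ : Measure (EuclideanSpace ℝ (Fin d))))
    (s := fun n : ℕ => Metric.closedBall s (1 / ((n : ℝ) + 1)))
    (fun n => Metric.isClosed_closedBall.measurableSet.nullMeasurableSet)
    (fun m n hmn => Metric.closedBall_subset_closedBall (by gcongr))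
    ⟨0, measure_ne_top _ _⟩
  rw [hinter] at hlim2
  have := ge_of_tendsto' hlim2 fun n => hball _ (by positivity)
  exact (ENNReal.ofReal_pos.2 hε).trans_le this

end QRW

/-! ### Correlations and superpositions of kicked evolutions. -/

section KickedLimit

open Complex

variable {c : ℕ} {U : CoinSpace c →ₗᵢ[ℂ] CoinSpace c} {a : Fin c → ℝ}
  {b : OrthonormalBasis (Fin c) ℂ (CoinSpace c)} {l : Fin c → ℂ} {α : Fin c → ℝ}

lemma IsAdaptedBasis.realDiag_mul (h : IsAdaptedBasis U (realDiag a) b l α) (τ : ℝ) :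
    IsAdaptedBasis U (realDiag fun v => τ * a v) b l fun i => τ * α i where
  norm_eq_one := h.norm_eq_one
  apply_eq := h.apply_eq
  inner_eq i w hw := by
    have h1 : (realDiag fun v => τ * a v) (b i) = (τ : ℂ) • realDiag a (b i) := by
      ext v; simp [mul_assoc]
    rw [h1, inner_smul_right, h.inner_eq i w hw]
    push_cast; ring

lemma tendsto_smul_phaseExp_sub (a : Fin c → ℝ) (w : CoinSpace c) :
    Tendsto (fun T : ℕ => (T : ℂ) • (phaseExp a (T : ℝ)⁻¹ w - w)) atTop
      (𝓝 (I • realDiag a w)) := by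
  have hs : Tendsto (fun T : ℕ => ((T : ℂ))⁻¹) atTop (𝓝[≠] 0) := by
    refine tendsto_nhdsWithin_iff.2 ⟨tendsto_inv_atTop_nhds_zero_nat (𝕜 := ℂ), ?_⟩
    filter_upwards [eventually_gt_atTop 0] with T hT
    simpa using hT.ne'
  refine (tendsto_inv_smul_diagMap_sub hs a w).congr fun T => ?_
  rw [inv_inv, ← LinearIsometry.coe_toLinearMap, toLinearMap_phaseExp]
  simp

lemma IsAdaptedBasis.pow_apply (h : IsAdaptedBasis U (realDiag a) b l α) (T : ℕ) (i : Fin c) :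
    (U ^ T) (b i) = l i ^ T • b i := by
  induction T with
  | zero => simp
  | succ T ih =>
    rw [pow_succ' U, pow_succ' (l i)]
    change U ((U ^ T) (b i)) = _
    rw [ih, map_smul, h.apply_eq, smul_smul, mul_comm]

lemma IsAdaptedBasis.tendsto_pow_apply_sub (h : IsAdaptedBasis U (realDiag a) b l α)
    (u : CoinSpace c) :
    Tendsto (fun T : ℕ => (((phaseExp a (T : ℝ)⁻¹).comp U) ^ T) u -
      ∑ i, (inner ℂ (b i) u * exp (I * α i) * l i ^ T) • b i) atTop (𝓝 0) := by
  have h1 := tendsto_finsetSum Finset.univ fun i _ =>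
    (h.tendsto_pow_sub (tendsto_smul_phaseExp_sub a) i).const_smul (inner ℂ (b i) u)
  simp only [smul_zero, Finset.sum_const_zero] at h1
  refine h1.congr fun T => ?_
  conv_rhs => rw [← b.sum_repr' u, map_sum]
  rw [← Finset.sum_sub_distrib]
  refine Finset.sum_congr rfl fun i _ => ?_
  rw [map_smul, smul_sub, smul_smul, b.sum_repr' u, mul_assoc]

/-- The limit of the correlation between the free and the kicked evolution. -/
lemma IsAdaptedBasis.tendsto_inner_pow (h : IsAdaptedBasis U (realDiag a) b l α)
    (u : CoinSpace c) :
    Tendsto (fun T : ℕ => inner ℂ ((U ^ T) u) ((((phaseExp a (T : ℝ)⁻¹).comp U) ^ T) u)) atTop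
      (𝓝 (∑ i, ‖inner ℂ (b i) u‖ ^ 2 * exp (I * α i))) := by
  have h1 := h.tendsto_pow_apply_sub u
  have h2 : Tendsto (fun T : ℕ => inner ℂ ((U ^ T) u) ((((phaseExp a (T : ℝ)⁻¹).comp U) ^ T) u -
      ∑ i, (inner ℂ (b i) u * exp (I * α i) * l i ^ T) • b i)) atTop (𝓝 0) := by
    refine squeeze_zero_norm (fun T => norm_inner_le_norm _ _) ?_
    simp only [LinearIsometry.norm_map]
    simpa using (tendsto_norm_zero.comp h1).const_mul ‖u‖
  -- The factors `l i ^ T` are absorbed by the free evolution, so this correlation does not depend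
  -- on T.
  have h3 : ∀ T : ℕ, inner ℂ ((U ^ T) u) (∑ i, (inner ℂ (b i) u * exp (I * α i) * l i ^ T) • b i) =
      ∑ i, ((‖inner ℂ (b i) u‖ ^ 2 * exp (I * α i) : ℂ)) := by
    intro T
    rw [inner_sum]
    refine Finset.sum_congr rfl fun i _ => ?_
    rw [← smul_smul, ← h.pow_apply, inner_smul_right,
      LinearIsometry.inner_map_map, ← inner_conj_symm u (b i)]
    rw [mul_comm (inner ℂ (b i) u) (exp _), mul_assoc, Complex.mul_conj,
      Complex.normSq_eq_norm_sq, mul_comm]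
    push_cast
    ring
  have h4 := h2.add_const (∑ i, ((‖inner ℂ (b i) u‖ ^ 2 * exp (I * α i) : ℂ)))
  rw [zero_add] at h4
  refine h4.congr fun T => ?_
  rw [← h3 T, inner_sub_right, sub_add_cancel]

/-- The limit of the norm of a superposition of kicked evolutions. -/
lemma IsAdaptedBasis.tendsto_norm_sum_pow (h : IsAdaptedBasis U (realDiag a) b l α)
    (u : CoinSpace c) {ι : Type*} (N : Finset ι) (w : ι → ℂ) (τ : ι → ℝ) :
    Tendsto (fun T : ℕ => ‖∑ n ∈ N, w n •
      (((phaseExp (fun v => τ n * a v) (T : ℝ)⁻¹).comp U) ^ T) u‖ ^ 2) atTop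
      (𝓝 (∑ i, ‖inner ℂ (b i) u‖ ^ 2 * ‖∑ n ∈ N, w n * exp (I * (τ n * α i : ℝ))‖ ^ 2)) := by
  have h1 := tendsto_finsetSum N fun n _ =>
    ((h.realDiag_mul (τ n)).tendsto_pow_apply_sub u).const_smul (w n)
  simp only [smul_zero, Finset.sum_const_zero] at h1
  set Y : ℕ → CoinSpace c := fun T => ∑ i, (inner ℂ (b i) u *
    (∑ n ∈ N, w n * exp (I * (τ n * α i : ℝ))) * l i ^ T) • b i with hY
  set X : ℕ → CoinSpace c := fun T => ∑ n ∈ N, w n •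
      (((phaseExp (fun v => τ n * a v) (T : ℝ)⁻¹).comp U) ^ T) u with hX
  have h2 : Tendsto (fun T => X T - Y T) atTop (𝓝 0) := by
    refine h1.congr fun T => ?_
    simp only [hX, hY, smul_sub, Finset.sum_sub_distrib, Finset.smul_sum, smul_smul]
    congr 1
    rw [Finset.sum_comm]
    refine Finset.sum_congr rfl fun i _ => ?_
    rw [← Finset.sum_smul, Finset.mul_sum, Finset.sum_mul]
    congr 1
    refine Finset.sum_congr rfl fun n _ => ?_
    ring
  have h3 : ∀ T, ‖Y T‖ ^ 2 =
      ∑ i, ‖inner ℂ (b i) u‖ ^ 2 * ‖∑ n ∈ N, w n * exp (I * (τ n * α i : ℝ))‖ ^ 2 := by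
    intro T
    rw [hY, ← b.sum_sq_norm_inner_right]
    refine Finset.sum_congr rfl fun i _ => ?_
    rw [b.orthonormal.inner_right_fintype, norm_mul, norm_mul, norm_pow, h.norm_eq_one, one_pow,
      mul_one, mul_pow]
  have h4 : Tendsto (fun T => ‖X T‖ - ‖Y T‖) atTop (𝓝 0) :=
    squeeze_zero_norm (fun T => abs_norm_sub_norm_le _ _) (tendsto_norm_zero.comp h2)
  have hYc : ∀ T, ‖Y T‖ = √(∑ i, ‖inner ℂ (b i) u‖ ^ 2 *
      ‖∑ n ∈ N, w n * exp (I * (τ n * α i : ℝ))‖ ^ 2) := fun T => by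
    rw [← h3 T, Real.sqrt_sq (norm_nonneg _)]
  have h5 : Tendsto (fun T => ‖X T‖) atTop (𝓝 (√(∑ i, ‖inner ℂ (b i) u‖ ^ 2 *
      ‖∑ n ∈ N, w n * exp (I * (τ n * α i : ℝ))‖ ^ 2))) := by
    have := h4.add_const (√(∑ i, ‖inner ℂ (b i) u‖ ^ 2 *
      ‖∑ n ∈ N, w n * exp (I * (τ n * α i : ℝ))‖ ^ 2))
    rw [zero_add] at this
    refine this.congr fun T => ?_
    rw [hYc, sub_add_cancel]
  have h6 := h5.pow 2
  rwa [Real.sq_sqrt (by positivity)] at h6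

end KickedLimit

/-! ### Existence of the limit measure. -/

namespace QRW

open Complex

variable {d c : ℕ}

/-- The velocities of the jumps in the direction `ξ`. -/
def jumpDot (W : QRW d c) (ξ : Fin d → ℝ) (v : Fin c) : ℝ := ∑ i, W.jump v i * ξ i

/-- Translation by the point of the torus corresponding to the real vector `y / 2π`. -/
def torusPt (y : Fin d → ℝ) : Torus d := torusMk ((2 * Real.pi)⁻¹ • y)

lemma torusChar_torusPt (m : Fin d → ℤ) (y : Fin d → ℝ) :
    torusChar m (torusPt y) = Circle.exp (∑ i, m i * y i) := by
  rw [torusPt, torusChar_mk]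
  congr 1
  rw [Finset.mul_sum]
  refine Finset.sum_congr rfl fun i _ => ?_
  simp only [Pi.smul_apply, smul_eq_mul]
  field_simp

lemma symbol_add_torusPt (W : QRW d c) (z : Torus d) (t : ℝ) (ξ : Fin d → ℝ) :
    W.symbol (z + torusPt (t • ξ)) = (phaseExp (W.jumpDot ξ) t).comp (W.symbol z) := by
  rw [symbol_add, phaseExp]
  congr 2
  funext v
  rw [torusChar_torusPt, jumpDot, Finset.sum_mul]
  congr 1
  refine Finset.sum_congr rfl fun i _ => ?_
  simp; ring

lemma charFun_rescaledMeasure (W : QRW d c) (u : CoinSpace c) (T : ℕ)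
    (ξ : EuclideanSpace ℝ (Fin d)) :
    charFun (W.rescaledMeasure u T) ξ = ∫ z, inner ℂ (((W.symbol z) ^ T) u)
      ((((phaseExp (W.jumpDot ξ) (T : ℝ)⁻¹).comp (W.symbol z)) ^ T) u) := by
  simp only [← symbol_add_torusPt]
  rw [← sum_siteProb_char, charFun_apply, integral_rescaledMeasure]
  refine Finset.sum_congr rfl fun x _ => ?_
  rw [torusChar_torusPt, Circle.coe_exp, real_smul, mul_comm]
  congr 3
  simp [PiLp.inner_apply, latticePoint]
  refine Finset.sum_congr rfl fun i _ => ?_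
  ring

/-- At each momentum the correlation converges, and it is bounded by 1, so dominated convergence
applies. The adapted bases need not depend measurably on the momentum. -/
theorem exists_isLimitMeasure (W : QRW d c) (u : CoinSpace c) (hu : ‖u‖ = 1) :
    ∃ μ, W.IsLimitMeasure u hu μ := by
  refine W.exists_isLimitMeasure_of_charFun u hu fun ξ => ?_
  have hpt : ∀ z, ∃ y, Tendsto (fun T : ℕ => inner ℂ (((W.symbol z) ^ T) u)
      ((((phaseExp (W.jumpDot ξ) (T : ℝ)⁻¹).comp (W.symbol z)) ^ T) u)) atTop (𝓝 y) := by
    intro z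
    obtain ⟨b, l, α, h⟩ := LinearIsometry.exists_isAdaptedBasis (n := c) (by simp) (W.symbol z)
      (isSymmetric_realDiag (W.jumpDot ξ))
    exact ⟨_, h.tendsto_inner_pow u⟩
  choose L hL using hpt
  refine ⟨∫ z, L z, ?_⟩
  simp only [charFun_rescaledMeasure]
  refine tendsto_integral_of_dominated_convergence (fun _ => 1) (fun T => ?_) (integrable_const 1)
    (fun T => Eventually.of_forall fun z => ?_) (Eventually.of_forall hL)
  · simp only [← symbol_add_torusPt]
    refine Continuous.aestronglyMeasurable ?_
    exact (W.continuous_symbol_pow_apply u T).inner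
      ((W.continuous_symbol_pow_apply u T).comp (continuous_add_const _))
  · refine (norm_inner_le_norm _ _).trans ?_
    simp [hu]

end QRW

/-! ### Trigonometric polynomials on a generic line. -/

section Exponentials

open Complex

variable {d : ℕ}

/-- The exponential `y ↦ e^{i b·y}`. -/
def realChar (b y : Fin d → ℝ) : ℂ := exp (I * (∑ i, b i * y i : ℝ))

lemma realChar_add (b b' y : Fin d → ℝ) : realChar (b + b') y = realChar b y * realChar b' y := by
  rw [realChar, realChar, realChar, ← exp_add, ← mul_add, ← ofReal_add, ← Finset.sum_add_distrib]
  congr 4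
  funext i
  simp [add_mul]

lemma realChar_zero (y : Fin d → ℝ) : realChar 0 y = 1 := by simp [realChar]

/-- The algebra of trigonometric polynomials with frequencies in a group. -/
def trigAlgebra (Λ : AddSubgroup (Fin d → ℝ)) : Subalgebra ℂ ((Fin d → ℝ) → ℂ) :=
  (Submodule.span ℂ (Set.range fun b : Λ => realChar b.1)).toSubalgebra
    (Submodule.subset_span ⟨0, funext fun y => realChar_zero y⟩) (by
      intro f g hf hg
      induction hf, hg using Submodule.span_induction₂ with
      | mem_mem f g hf hg =>
        obtain ⟨b, rfl⟩ := hf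
        obtain ⟨b', rfl⟩ := hg
        exact Submodule.subset_span ⟨b + b', funext fun y => realChar_add b.1 b'.1 y⟩
      | zero_left g hg => simp
      | zero_right f hf => simp
      | add_left f g h _ _ _ h1 h2 => rw [add_mul]; exact add_mem h1 h2
      | add_right f g h _ _ _ h1 h2 => rw [mul_add]; exact add_mem h1 h2
      | smul_left r f g _ _ h => rw [smul_mul_assoc]; exact Submodule.smul_mem _ _ h
      | smul_right r f g _ _ h => rw [mul_smul_comm]; exact Submodule.smul_mem _ _ h)

lemma realChar_mem_trigAlgebra {Λ : AddSubgroup (Fin d → ℝ)} {b : Fin d → ℝ} (hb : b ∈ Λ) :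
    realChar b ∈ trigAlgebra Λ :=
  Submodule.subset_span ⟨⟨b, hb⟩, rfl⟩

/-- The character `t ↦ e^{iκt}` of the real line. -/
def lineChar (κ : ℝ) : Multiplicative ℝ →* ℂ where
  toFun t := exp (I * (κ * t.toAdd : ℝ))
  map_one' := by simp
  map_mul' s t := by rw [← exp_add, toAdd_mul, ← mul_add, ← ofReal_add, mul_add]

lemma lineChar_injective : Function.Injective lineChar := by
  intro κ κ' h
  by_contra hne
  have hne' : κ - κ' ≠ 0 := sub_ne_zero.2 hne
  have h1 := DFunLike.congr_fun h (Multiplicative.ofAdd (Real.pi / (κ - κ')))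
  simp only [lineChar, MonoidHom.coe_mk, OneHom.coe_mk, toAdd_ofAdd] at h1
  have h2 : (I * (κ * (Real.pi / (κ - κ')) : ℝ) : ℂ) =
      I * (κ' * (Real.pi / (κ - κ')) : ℝ) + Real.pi * I := by
    have : κ * (Real.pi / (κ - κ')) = κ' * (Real.pi / (κ - κ')) + Real.pi := by
      field_simp; ring
    rw [this]; push_cast; ring
  rw [h2, exp_add, exp_pi_mul_I] at h1
  have h3 := exp_ne_zero (I * (κ' * (Real.pi / (κ - κ')) : ℝ))
  apply h3
  linear_combination -h1 / 2

/-- A trigonometric polynomial which vanishes on a generic line vanishes. -/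
lemma eq_zero_of_mem_trigAlgebra {Λ : AddSubgroup (Fin d → ℝ)} {θ : Fin d → ℝ}
    (hθ : ∀ b ∈ Λ, ∑ i, b i * θ i = 0 → b = 0) {f : (Fin d → ℝ) → ℂ} (hf : f ∈ trigAlgebra Λ)
    (h : ∀ t : ℝ, f (t • θ) = 0) : f = 0 := by
  obtain ⟨w, rfl⟩ := (Finsupp.mem_span_range_iff_exists_finsupp).1 hf
  -- Genericity of θ makes distinct frequencies restrict to distinct characters of the line, and
  -- these are linearly independent by Dedekind.
  have hinj : Function.Injective fun b : Λ => lineChar (∑ i, b.1 i * θ i) := by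
    intro b b' hb
    have h1 := lineChar_injective hb
    have h2 := hθ (b - b').1 (b - b').2 (by
      simp [sub_mul, Finset.sum_sub_distrib, h1])
    exact sub_eq_zero.1 (Subtype.ext h2)
  have hli := (linearIndependent_monoidHom (Multiplicative ℝ) ℂ).comp _ hinj
  have hw : w = 0 := by
    refine linearIndependent_iff.1 hli w (funext fun t => ?_)
    rw [Finsupp.linearCombination_apply, Finsupp.sum, Finset.sum_apply]
    have h1 := h t.toAdd
    rw [Finsupp.sum, Finset.sum_apply] at h1
    rw [Pi.zero_apply, ← h1]
    refine Finset.sum_congr rfl fun b _ => ?_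
    simp only [Function.comp_apply, Pi.smul_apply, lineChar, MonoidHom.coe_mk, OneHom.coe_mk,
      realChar]
    congr 4
    rw [Finset.sum_mul]
    refine Finset.sum_congr rfl fun i _ => ?_
    simp; ring
  subst hw
  simp

/-- Almost every direction separates the points of a countable group. -/
lemma exists_generic_direction (Λ : AddSubgroup (Fin d → ℝ)) [Countable Λ] :
    ∃ θ : Fin d → ℝ, ∀ b ∈ Λ, ∑ i, b i * θ i = 0 → b = 0 := by
  have h : ∀ b : Λ, ∀ᵐ θ : Fin d → ℝ, ∑ i, b.1 i * θ i = 0 → b.1 = 0 := by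
    intro b
    by_cases hb : b.1 = 0
    · exact Eventually.of_forall fun _ _ => hb
    · let L : (Fin d → ℝ) →ₗ[ℝ] ℝ := ∑ i, b.1 i • LinearMap.proj i
      have hL : ∀ θ, L θ = ∑ i, b.1 i * θ i := fun θ => by simp [L]
      have hne : LinearMap.ker L ≠ ⊤ := by
        intro htop
        apply hb
        funext i
        have h1 : Pi.single i 1 ∈ LinearMap.ker L := htop ▸ Submodule.mem_top
        rw [LinearMap.mem_ker, hL] at h1
        simpa [Pi.single_apply] using h1
      have h2 := Measure.addHaar_submodule (volume : Measure (Fin d → ℝ)) _ hne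
      rw [ae_iff]
      refine measure_mono_null (fun θ hθ => ?_) h2
      simp only [Set.mem_ofPred_eq, Classical.not_imp] at hθ
      exact LinearMap.mem_ker.2 ((hL θ).trans hθ.1)
  obtain ⟨θ, hθ⟩ := (ae_all_iff.2 h).exists
  exact ⟨θ, fun b hb => hθ ⟨b, hb⟩⟩

end Exponentials

/-! ### Flat bands and the rationality of their velocities. -/

namespace QRW

open Complex

variable {d c : ℕ}

/-- The velocities of the jumps relative to the drift `s`, in the direction `y`. -/
def driftDot (W : QRW d c) (s y : Fin d → ℝ) (v : Fin c) : ℝ := ∑ i, (W.jump v i - s i) * y i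

lemma driftDot_eq (W : QRW d c) (s y : Fin d → ℝ) (v : Fin c) :
    W.driftDot s y v = W.jumpDot y v - ∑ i, s i * y i := by
  simp [driftDot, jumpDot, sub_mul]

/-- The group generated by the jumps and by the drift. -/
def driftGroup (s : Fin d → ℝ) : AddSubgroup (Fin d → ℝ) :=
  (AddMonoidHom.mk' (fun p : ℤ × (Fin d → ℤ) => fun i => p.1 * s i + p.2 i) (by
    intro p q; funext i; simp; ring)).range

instance (s : Fin d → ℝ) : Countable (driftGroup s) := by
  unfold driftGroup
  exact (Set.countable_range _).to_subtype

lemma jump_sub_mem_driftGroup (W : QRW d c) (s : Fin d → ℝ) (v : Fin c) :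
    (fun i => W.jump v i - s i) ∈ driftGroup s :=
  ⟨(-1, W.jump v), by funext i; simp; ring⟩

/-- The eigenvalue `l` at the momentum `z` belongs to a band of constant velocity `s`. -/
def IsFlat (W : QRW d c) (s : Fin d → ℝ) (z : Torus d) (l : ℂ) : Prop :=
  ∀ y, LinearMap.det (l • LinearMap.id -
    ((phaseExp (W.driftDot s y) 1).comp (W.symbol z)).toLinearMap) = 0

lemma driftDot_smul (W : QRW d c) (s y : Fin d → ℝ) (t : ℝ) :
    phaseExp (W.driftDot s (t • y)) 1 = phaseExp (W.driftDot s y) t := by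
  unfold phaseExp
  congr 1
  funext v
  congr 1
  simp only [driftDot, mul_one, Finset.sum_mul, Pi.smul_apply, smul_eq_mul]
  refine Finset.sum_congr rfl fun i _ => ?_
  ring

/-- The kick multiplies row v of the symbol by e^{i(j_v - s)·y}, so the determinant is a
trigonometric polynomial in y with frequencies in `driftGroup s`. Such a function is determined by
its values on a generic line. -/
lemma isFlat_of_generic_line (W : QRW d c) {s θ : Fin d → ℝ}
    (hθ : ∀ b ∈ driftGroup s, ∑ i, b i * θ i = 0 → b = 0) {z : Torus d} {l : ℂ}
    (h : ∀ t : ℝ, LinearMap.det (l • LinearMap.id -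
      ((phaseExp (W.driftDot s θ) t).comp (W.symbol z)).toLinearMap) = 0) : W.IsFlat s z l := by
  set f : (Fin d → ℝ) → ℂ := fun y => LinearMap.det (l • LinearMap.id -
    ((phaseExp (W.driftDot s y) 1).comp (W.symbol z)).toLinearMap) with hf
  have hmem : f ∈ trigAlgebra (driftGroup s) := by
    set β := (EuclideanSpace.basisFun (Fin c) ℂ).toBasis
    set N : Fin c → Fin c → (Fin d → ℝ) → ℂ := fun v w =>
      algebraMap ℂ ((Fin d → ℝ) → ℂ) (l * (if v = w then 1 else 0)) -
        realChar (fun i => W.jump v i - s i) *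
          algebraMap ℂ ((Fin d → ℝ) → ℂ) (LinearMap.toMatrix β β (W.symbol z).toLinearMap v w)
      with hN
    have hNmem : ∀ v w, N v w ∈ trigAlgebra (driftGroup s) := fun v w =>
      sub_mem (Subalgebra.algebraMap_mem _ _) (mul_mem
        (realChar_mem_trigAlgebra (W.jump_sub_mem_driftGroup s v)) (Subalgebra.algebraMap_mem _ _))
    have hfN : f = ∑ σ : Equiv.Perm (Fin c), Equiv.Perm.sign σ • ∏ v, N (σ v) v := by
      funext y
      rw [hf, Finset.sum_apply]
      simp only
      rw [← LinearMap.det_toMatrix β, Matrix.det_apply]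
      refine Finset.sum_congr rfl fun σ _ => ?_
      rw [Pi.smul_apply, Finset.prod_apply]
      congr 1
      refine Finset.prod_congr rfl fun v _ => ?_
      have h1 : ∀ v, realChar (fun i => (W.jump v i : ℝ) - s i) y =
          (Circle.exp (W.driftDot s y v) : ℂ) := by
        intro v
        rw [realChar, Circle.coe_exp, driftDot, mul_comm]
      simp only [hN, LinearMap.toMatrix_apply, Pi.sub_apply, Pi.mul_apply, Pi.algebraMap_apply,
        Algebra.algebraMap_self, RingHom.id_apply, h1]
      simp [β, phaseExp]
    rw [hfN]
    refine sum_mem fun σ _ => ?_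
    rw [Units.smul_def]
    exact zsmul_mem (prod_mem fun v _ => hNmem _ _) _
  have h0 := eq_zero_of_mem_trigAlgebra hθ hmem fun t => by
    rw [hf]
    simp only [driftDot_smul]
    exact h t
  exact fun y => congrFun h0 y

/-- Restoring the drift phase e^{is·y} turns the kicked symbol into the symbol at the shifted
momentum: along a flat band the eigenvalue is carried around the torus as a plane wave. -/
lemma IsFlat.det_eq_zero {W : QRW d c} {s : Fin d → ℝ} {z : Torus d} {l : ℂ}
    (h : W.IsFlat s z l) (y : Fin d → ℝ) :
    LinearMap.det ((l * Circle.exp (∑ i, s i * y i)) • LinearMap.id -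
      (W.symbol (z + torusPt y)).toLinearMap) = 0 := by
  have h1 : (l * Circle.exp (∑ i, s i * y i)) • LinearMap.id -
      (W.symbol (z + torusPt y)).toLinearMap = (Circle.exp (∑ i, s i * y i) : ℂ) •
      (l • LinearMap.id - ((phaseExp (W.driftDot s y) 1).comp (W.symbol z)).toLinearMap) := by
    have h2 := W.symbol_add_torusPt z 1 y
    rw [one_smul] at h2
    rw [h2, smul_sub, smul_smul, mul_comm]
    congr 1
    ext x v
    simp only [phaseExp, LinearIsometry.coe_toLinearMap, LinearIsometry.coe_comp,
      Function.comp_apply, phase_apply, LinearMap.smul_apply, PiLp.smul_apply, smul_eq_mul,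
      mul_one]
    rw [← mul_assoc, ← Circle.coe_mul, ← Circle.exp_add, driftDot_eq, add_sub_cancel]
  rw [h1, LinearMap.det_smul, h y, mul_zero]

lemma torusPt_intCast (n : Fin d → ℤ) : torusPt (fun i => 2 * Real.pi * n i) = 0 := by
  funext i
  simp only [torusPt, torusMk, Pi.smul_apply, smul_eq_mul, Pi.zero_apply]
  rw [inv_mul_cancel_left₀ (by positivity)]
  have := AddCircle.coe_period (1 : ℝ)
  rw [← mul_one (n i : ℝ), ← zsmul_eq_mul, AddCircle.coe_zsmul, this, smul_zero]

lemma mem_roots_symbol (W : QRW d c) {z : Torus d} {x : ℂ}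
    (h : LinearMap.det (x • LinearMap.id - (W.symbol z).toLinearMap) = 0) :
    x ∈ (W.symbol z).toLinearMap.charpoly.roots := by
  rw [Polynomial.mem_roots (LinearMap.charpoly_monic _).ne_zero, Polynomial.IsRoot.def,
    LinearMap.eval_charpoly_eq_det, h]

/-- A band of constant velocity has rational velocity. -/
theorem IsFlat.exists_nat_smul_eq {W : QRW d c} {s : Fin d → ℝ} {z : Torus d} {l : ℂ}
    (h : W.IsFlat s z l) (hl : l ≠ 0) :
    ∃ k : ℕ, 1 ≤ k ∧ k ≤ c ∧ ∃ m : Fin d → ℤ, ∀ i, k * s i = m i := by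
  -- The phase acquired along the closed loop n. Each product of l with such a phase is again an
  -- eigenvalue at z, so the range is a group of order at most c. This order is the k of the
  -- conclusion.
  let ω : Multiplicative (Fin d → ℤ) →* Circle :=
    { toFun := fun n => Circle.exp (∑ i, s i * (2 * Real.pi * n.toAdd i))
      map_one' := by simp
      map_mul' := fun n n' => by
        rw [← Circle.exp_add, ← Finset.sum_add_distrib]
        congr 2
        funext i
        simp; ring }
  set R := (W.symbol z).toLinearMap.charpoly.roots.toFinset
  have hR : ∀ g : ω.range, l * (g.1 : ℂ) ∈ R := by
    rintro ⟨_, n, rfl⟩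
    rw [Multiset.mem_toFinset]
    have h1 := h.det_eq_zero (fun i => 2 * Real.pi * n.toAdd i)
    rw [torusPt_intCast, add_zero] at h1
    exact W.mem_roots_symbol h1
  have hinj : Function.Injective fun g : ω.range => (⟨l * (g.1 : ℂ), hR g⟩ : R) := by
    intro g g' hg
    have := mul_left_cancel₀ hl (Subtype.ext_iff.1 hg)
    exact Subtype.ext (Circle.coe_injective this)
  have hfin : Finite ω.range := Finite.of_injective _ hinj
  have hcard : Nat.card ω.range ≤ c := by
    calc Nat.card ω.range ≤ Nat.card R := Nat.card_le_card_of_injective _ hinj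
      _ = R.card := by simp
      _ ≤ (W.symbol z).toLinearMap.charpoly.roots.card := Multiset.toFinset_card_le _
      _ ≤ (W.symbol z).toLinearMap.charpoly.natDegree := Polynomial.card_roots' _
      _ = c := by rw [LinearMap.charpoly_natDegree]; simp
  refine ⟨Nat.card ω.range, Nat.card_pos, hcard, ?_⟩
  have hpow : ∀ i, ∃ m : ℤ, (Nat.card ω.range : ℝ) * s i = m := by
    intro i
    have h1 := pow_card_eq_one' (x := (⟨ω (Multiplicative.ofAdd (Pi.single i 1)), _, rfl⟩ : ω.range))
    have h2 := Subtype.ext_iff.1 h1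
    simp only [SubgroupClass.coe_pow, OneMemClass.coe_one, ω, MonoidHom.coe_mk, OneHom.coe_mk,
      toAdd_ofAdd, ← Circle.exp_nsmul] at h2
    rw [Circle.exp_eq_one] at h2
    obtain ⟨m, hm⟩ := h2
    refine ⟨m, ?_⟩
    have hpi : (2 * Real.pi) ≠ 0 := by positivity
    have h3 : ∑ j, s j * (2 * Real.pi * ((Pi.single i 1 : Fin d → ℤ) j : ℝ)) =
        s i * (2 * Real.pi) := by
      rw [Finset.sum_eq_single i]
      · simp
      · intro j _ hj; simp [hj]
      · simp
    rw [h3, nsmul_eq_mul] at hm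
    apply mul_right_cancel₀ hpi
    linarith
  choose m hm using hpow
  exact ⟨m, hm⟩

/-- On a band of constant rational velocity, a power of the eigenvalue is a character. -/
lemma IsFlat.exists_pow_eq {W : QRW d c} {s : Fin d → ℝ} {z : Torus d} {l : ℂ}
    (h : W.IsFlat s z l) {k : ℕ} {m : Fin d → ℤ} (hk : ∀ i, k * s i = m i) :
    ∃ r ∈ (W.symbol 0).toLinearMap.charpoly.roots, ‖r‖ = ‖l‖ ∧ l ^ k = r ^ k * torusChar m z := by
  obtain ⟨x, hx⟩ := torusMk_surjective z
  -- This y carries z to momentum 0, so that r belongs to a finite set independent of z. The k-th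
  -- power removes the dependence on the representative x.
  set y : Fin d → ℝ := (-(2 * Real.pi)) • x with hy
  have hpt : torusPt y = -z := by
    rw [← hx, torusPt, hy, smul_smul]
    have : (2 * Real.pi)⁻¹ * -(2 * Real.pi) = -1 := by
      have : Real.pi ≠ 0 := Real.pi_ne_zero
      field_simp
    rw [this]
    funext i
    simp [torusMk]
  have h1 := h.det_eq_zero y
  rw [hpt, add_neg_cancel] at h1
  refine ⟨_, W.mem_roots_symbol h1, by rw [norm_mul, Circle.norm_coe, mul_one], ?_⟩
  have h2 : Circle.exp (∑ i, s i * y i) ^ k = torusChar m (-z) := by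
    rw [← hpt, torusChar_torusPt, ← Circle.exp_nsmul, nsmul_eq_mul, Finset.mul_sum]
    congr 2
    funext i
    rw [← hk]; ring
  have h3 : torusChar m (-z) * torusChar m z = 1 := by
    rw [← torusChar_apply_add, neg_add_cancel, torusChar_apply_zero]
  rw [mul_pow, ← Circle.coe_pow, h2, mul_assoc, ← Circle.coe_mul, h3, Circle.coe_one, mul_one]

end QRW

/-! ### Ergodic averages and amplitudes along rays. -/

section Averages

/-- The averages of the powers of a number of modulus one. -/
lemma tendsto_average_pow {q : ℂ} (hq : ‖q‖ = 1) :
    Tendsto (fun N : ℕ => (N : ℂ)⁻¹ * ∑ n ∈ Finset.range N, q ^ n) atTop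
      (𝓝 (if q = 1 then 1 else 0)) := by
  split_ifs with h
  · subst h
    refine tendsto_const_nhds.congr' ?_
    filter_upwards [eventually_ne_atTop 0] with N hN
    have : (N : ℂ) ≠ 0 := by exact_mod_cast hN
    simp [this]
  · have h1 : q - 1 ≠ 0 := sub_ne_zero.2 h
    refine squeeze_zero_norm (a := fun N : ℕ => (N : ℝ)⁻¹ * (2 / ‖q - 1‖)) (fun N => ?_) ?_
    · rw [norm_mul, geom_sum_eq h, norm_div, norm_inv, Complex.norm_natCast]
      gcongr
      refine (norm_sub_le _ _).trans ?_
      rw [norm_pow, hq, one_pow, norm_one]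
      norm_num
    · simpa using tendsto_inv_atTop_nhds_zero_nat.mul_const (2 / ‖q - 1‖)

end Averages

namespace QRW

variable {d c : ℕ}

lemma norm_waveFun_sq_eq (W : QRW d c) (u : CoinSpace c) (T : ℕ) (x : Fin d → ℤ) :
    ‖W.waveFun u T x‖ ^ 2 = ∑ v, W.prob u T x v := by
  rw [← siteProb_eq]; rfl

/-- If the amplitude along the ray `(n m, k n)` does not tend to zero, the walk localizes strongly
at the speed `m / k`. -/
lemma stronglyLocalizesAt_of_not_tendsto (W : QRW d c) {u : CoinSpace c} (hu : ‖u‖ = 1)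
    {s : EuclideanSpace ℝ (Fin d)} (hs : s ∈ W.jumpHull) {k : ℕ} (hk : 1 ≤ k) {m : Fin d → ℤ}
    (hm : ∀ i, k * s i = m i)
    (h : ¬ Tendsto (fun n : ℕ => W.waveFun u (k * n) (n • m)) atTop (𝓝 0)) :
    W.StronglyLocalizesAt u s := by
  rw [tendsto_zero_iff_norm_tendsto_zero, Metric.tendsto_atTop] at h
  push Not at h
  obtain ⟨ε, hε, h⟩ := h
  have hfreq : ∃ᶠ n : ℕ in atTop, ε ≤ ‖W.waveFun u (k * n) (n • m)‖ := by
    refine frequently_atTop.2 fun N => ?_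
    obtain ⟨n, hn, hn'⟩ := h N
    exact ⟨n, hn, by simpa using hn'⟩
  obtain ⟨φ, hφ, hφε⟩ := extraction_of_frequently_atTop (hfreq.and_eventually
    (eventually_ge_atTop 1))
  have hc : 0 < c := by
    rcases Nat.eq_zero_or_pos c with rfl | h
    · have : u = 0 := Subsingleton.elim _ _
      simp [this] at hu
    · exact h
  have hv : ∀ n, ∃ v, ε ^ 2 / c ≤ W.prob u (k * φ n) (φ n • m) v := by
    intro n
    by_contra hcon
    push Not at hcon
    have h1 : ∑ v, W.prob u (k * φ n) (φ n • m) v < ∑ _v : Fin c, ε ^ 2 / c := by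
      have : Nonempty (Fin c) := ⟨⟨0, hc⟩⟩
      exact Finset.sum_lt_sum_of_nonempty Finset.univ_nonempty fun v _ => hcon v
    have hc' : (c : ℝ) ≠ 0 := by exact_mod_cast hc.ne'
    have h2 : ∑ _v : Fin c, ε ^ 2 / (c : ℝ) = ε ^ 2 := by
      rw [Finset.sum_const, Finset.card_univ, Fintype.card_fin, nsmul_eq_mul,
        mul_div_cancel₀ _ hc']
    rw [← norm_waveFun_sq_eq, h2] at h1
    exact absurd (pow_le_pow_left₀ hε.le (hφε n).1 2) (not_le.2 h1)
  choose v hv using hv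
  refine ⟨hs, fun n => k * φ n, fun n => φ n • m, v, ?_, ?_, ?_⟩
  · exact (hφ.tendsto_atTop).const_mul_atTop' (by omega)
  · have h2 : ε ^ 2 / c ≤ liminf (fun n => W.prob u (k * φ n) (φ n • m) (v n)) atTop := by
      refine le_liminf_of_le ?_ (Eventually.of_forall hv)
      exact (isBoundedUnder_of ⟨1, fun n => W.prob_le_one hu _ _ _⟩).isCoboundedUnder_ge
    refine lt_of_lt_of_le ?_ h2
    positivity
  · refine tendsto_const_nhds.congr fun n => ?_
    ext i
    have h3 : (φ n : ℝ) ≠ 0 := by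
      have := (hφε n).2
      exact_mod_cast (by omega : φ n ≠ 0)
    have h4 : (k : ℝ) ≠ 0 := by exact_mod_cast (by omega : k ≠ 0)
    simp only [PiLp.smul_apply, latticePoint, smul_eq_mul, Pi.smul_apply]
    push_cast
    rw [nsmul_eq_mul]
    push_cast
    rw [← hm i]
    field_simp

/-- If the amplitude along a ray tends to zero, the initial state is orthogonal to the
corresponding bands. -/
lemma ae_inner_eq_zero_of_tendsto (W : QRW d c) {u : CoinSpace c} (hu : ‖u‖ = 1) {k : ℕ}
    {m : Fin d → ℤ} (h : Tendsto (fun n : ℕ => W.waveFun u (k * n) (n • m)) atTop (𝓝 0))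
    {μ : ℂ} (hμ : ‖μ‖ = 1) :
    ∀ᵐ z, ∀ (l : ℂ) (x : CoinSpace c), W.symbol z x = l • x → l ^ k = μ * torusChar m z →
      inner ℂ x u = 0 := by
  -- The integral of `f N` is a Cesàro mean of amplitudes along the ray, twisted by the conjugate of
  -- μ^n. Pointwise, `f N` tends to the mass g of u on the eigenvectors with l^k = μ χ_m(z).
  set f : ℕ → Torus d → ℂ := fun N z => (N : ℂ)⁻¹ * ∑ n ∈ Finset.range N,
    inner ℂ ((μ ^ n * (torusChar (n • m) z : ℂ)) • u) (((W.symbol z) ^ (k * n)) u) with hf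
  have hbasis : ∀ z, ∃ (b : OrthonormalBasis (Fin c) ℂ (CoinSpace c)) (l α : _),
      IsAdaptedBasis (W.symbol z) (realDiag (0 : Fin c → ℝ)) b l α := fun z =>
    LinearIsometry.exists_isAdaptedBasis (by simp) _ (isSymmetric_realDiag 0)
  choose b l α hb using hbasis
  set g : Torus d → ℝ := fun z => ∑ i, ‖inner ℂ (b z i) u‖ ^ 2 *
    (if (starRingEnd ℂ) (μ * torusChar m z) * l z i ^ k = 1 then 1 else 0) with hg
  have hlim : ∀ z, Tendsto (fun N => f N z) atTop (𝓝 (g z : ℂ)) := by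
    intro z
    have h1 : ∀ n : ℕ, inner ℂ ((μ ^ n * (torusChar (n • m) z : ℂ)) • u)
        (((W.symbol z) ^ (k * n)) u) = ∑ i, ((‖inner ℂ (b z i) u‖ ^ 2 : ℝ) : ℂ) *
          ((starRingEnd ℂ) (μ * torusChar m z) * l z i ^ k) ^ n := by
      intro n
      conv_lhs => rw [inner_smul_left]; arg 2; rw [← (b z).sum_repr' u]
      rw [sum_inner, Finset.mul_sum]
      refine Finset.sum_congr rfl fun i _ => ?_
      have h2 : inner ℂ (b z i) (((W.symbol z) ^ (k * n)) u) =
          l z i ^ (k * n) * inner ℂ (b z i) u := by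
        conv_lhs => rw [← (b z).sum_repr' u, map_sum]
        simp only [map_smul, (hb z).pow_apply]
        rw [inner_sum, Finset.sum_eq_single i]
        · rw [inner_smul_right, inner_smul_right, inner_self_eq_norm_sq_to_K,
            (b z).norm_eq_one]
          simp; ring
        · intro j _ hj
          rw [inner_smul_right, inner_smul_right, (b z).orthonormal.inner_eq_zero hj.symm]
          simp
        · simp
      rw [(b z).sum_repr' u, inner_smul_left, h2, torusChar_nsmul, Circle.coe_pow, ← mul_pow,
        map_pow, mul_pow, pow_mul]
      have h3 : (starRingEnd ℂ) (inner ℂ (b z i) u) * inner ℂ (b z i) u =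
          ((‖inner ℂ (b z i) u‖ ^ 2 : ℝ) : ℂ) := by
        rw [mul_comm, Complex.mul_conj, Complex.normSq_eq_norm_sq]
      rw [← h3]
      ring
    have h4 : ∀ i, ‖(starRingEnd ℂ) (μ * torusChar m z) * l z i ^ k‖ = 1 := by
      intro i
      rw [norm_mul, RCLike.norm_conj, norm_mul, hμ, Circle.norm_coe, norm_pow,
        (hb z).norm_eq_one, one_pow]
      norm_num
    have h5 := tendsto_finsetSum Finset.univ fun i _ =>
      (tendsto_average_pow (h4 i)).const_mul ((‖inner ℂ (b z i) u‖ ^ 2 : ℝ) : ℂ)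
    have h6 : (g z : ℂ) = ∑ i, ((‖inner ℂ (b z i) u‖ ^ 2 : ℝ) : ℂ) *
        (if (starRingEnd ℂ) (μ * torusChar m z) * l z i ^ k = 1 then 1 else 0) := by
      rw [hg]; push_cast
      refine Finset.sum_congr rfl fun i _ => ?_
      split_ifs <;> simp
    rw [h6]
    refine h5.congr fun N => ?_
    simp only [hf, h1]
    rw [Finset.sum_comm, Finset.mul_sum]
    refine Finset.sum_congr rfl fun i _ => ?_
    rw [← Finset.mul_sum]
    ring
  have hcont : ∀ N, Continuous (f N) := by
    intro N
    refine continuous_const.mul (continuous_finsetSum _ fun n _ => ?_)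
    refine Continuous.inner ?_ (W.continuous_symbol_pow_apply u (k * n))
    fun_prop
  have hbound : ∀ N z, ‖f N z‖ ≤ 1 := by
    intro N z
    rw [hf]
    simp only
    rw [norm_mul, norm_inv, Complex.norm_natCast]
    have h1 : ‖∑ n ∈ Finset.range N, inner ℂ ((μ ^ n * (torusChar (n • m) z : ℂ)) • u)
        (((W.symbol z) ^ (k * n)) u)‖ ≤ N := by
      refine (norm_sum_le_of_le _ (f := fun n : ℕ => inner ℂ
        ((μ ^ n * (torusChar (n • m) z : ℂ)) • u) (((W.symbol z) ^ (k * n)) u))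
        (n := fun _ => (1 : ℝ)) fun n _ => ?_).trans (by simp)
      refine (norm_inner_le_norm _ _).trans ?_
      rw [norm_smul, norm_mul, norm_pow, hμ, Circle.norm_coe, LinearIsometry.norm_map, hu]
      simp
    refine (mul_le_mul_of_nonneg_left h1 (by positivity)).trans ?_
    exact inv_mul_le_one
  have hint : Tendsto (fun N => ∫ z, f N z) atTop (𝓝 (∫ z, (g z : ℂ))) :=
    tendsto_integral_of_dominated_convergence (fun _ => 1)
      (fun N => (hcont N).aestronglyMeasurable) (integrable_const 1)
      (fun N => Eventually.of_forall (hbound N)) (Eventually.of_forall hlim)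
  have hzero : Tendsto (fun N => ∫ z, f N z) atTop (𝓝 0) := by
    have h1 : ∀ N, ∫ z, f N z = (N : ℂ)⁻¹ * ∑ n ∈ Finset.range N,
        (starRingEnd ℂ) (μ ^ n) * inner ℂ u (W.waveFun u (k * n) (n • m)) := by
      intro N
      simp only [hf, integral_const_mul]
      rw [integral_finsetSum]
      · congr 1
        refine Finset.sum_congr rfl fun n _ => ?_
        rw [inner_waveFun, ← integral_const_mul]
        congr 1
        funext z
        rw [mul_smul, inner_smul_left]
      · intro n _
        refine integrable_of_continuous_torus (Continuous.inner ?_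
          (W.continuous_symbol_pow_apply u (k * n)))
        fun_prop
    have h2 : Tendsto (fun n : ℕ => (starRingEnd ℂ) (μ ^ n) *
        inner ℂ u (W.waveFun u (k * n) (n • m))) atTop (𝓝 0) := by
      refine squeeze_zero_norm (a := fun n : ℕ => ‖W.waveFun u (k * n) (n • m)‖) (fun n => ?_)
        (tendsto_zero_iff_norm_tendsto_zero.1 h)
      rw [norm_mul, RCLike.norm_conj, norm_pow, hμ, one_pow, one_mul]
      refine (norm_inner_le_norm _ _).trans ?_
      rw [hu, one_mul]
    have h3 := h2.cesaro_smul
    refine h3.congr fun N => ?_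
    rw [h1, Complex.real_smul]
    push_cast
    rfl
  have hg0 : ∫ z, g z = 0 := by
    have h1 := tendsto_nhds_unique hint hzero
    rw [integral_complex_ofReal] at h1
    exact_mod_cast h1
  have hgnn : ∀ z, 0 ≤ g z := fun z => by
    rw [hg]
    refine Finset.sum_nonneg fun i _ => ?_
    split_ifs <;> positivity
  -- The bases were chosen without measurability, but g is a pointwise limit of continuous
  -- functions.
  have hgmeas : AEStronglyMeasurable g volume := by
    have h1 : AEStronglyMeasurable (fun z => (g z : ℂ)) volume :=
      aestronglyMeasurable_of_tendsto_ae atTop (fun N => (hcont N).aestronglyMeasurable)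
        (Eventually.of_forall hlim)
    simpa using h1.re
  have hgint : Integrable g := by
    refine Integrable.of_bound hgmeas 1 (Eventually.of_forall fun z => ?_)
    have h1 := le_of_tendsto' (hlim z).norm fun N => hbound N z
    simpa using h1
  have hae := (integral_eq_zero_iff_of_nonneg hgnn hgint).1 hg0
  -- An eigenvector x has components only along the basis vectors with the same eigenvalue, and
  -- these are orthogonal to u because g vanishes at z.
  filter_upwards [hae] with z hz l' x hx hl'
  rw [← (b z).sum_inner_mul_inner]
  refine Finset.sum_eq_zero fun i _ => ?_
  by_cases hli : l z i = l'
  · have h1 : ‖inner ℂ (b z i) u‖ ^ 2 *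
        (if (starRingEnd ℂ) (μ * torusChar m z) * l z i ^ k = 1 then (1 : ℝ) else 0) = 0 := by
      refine (Finset.sum_eq_zero_iff_of_nonneg fun i _ => ?_).1 hz i (Finset.mem_univ i)
      split_ifs <;> positivity
    have h2 : (starRingEnd ℂ) (μ * torusChar m z) * l z i ^ k = 1 := by
      rw [hli, hl', mul_comm, Complex.mul_conj, Complex.normSq_eq_norm_sq, norm_mul, hμ,
        Circle.norm_coe]
      simp
    rw [if_pos h2, mul_one] at h1
    have h3 : inner ℂ (b z i) u = 0 := by simpa using h1
    rw [h3, mul_zero]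
  · rw [(W.symbol z).inner_eq_zero_of_eigenvalue_ne hx ((hb z).apply_eq i) (Ne.symm hli), zero_mul]

end QRW

/-! ### Phases, and passage to almost every line. -/

section Isometries

open Complex

variable {c : ℕ}

lemma pow_apply_of_eq_smul {U V : CoinSpace c →ₗᵢ[ℂ] CoinSpace c} {e : ℂ}
    (h : ∀ x, U x = e • V x) (T : ℕ) (x : CoinSpace c) : (U ^ T) x = e ^ T • (V ^ T) x := by
  induction T generalizing x with
  | zero => simp
  | succ T ih =>
    rw [pow_succ U, pow_succ V]
    change (U ^ T) (U x) = _ • (V ^ T) (V x)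
    rw [h, map_smul, ih, smul_smul, pow_succ, mul_comm]

lemma phaseExp_mul (a : Fin c → ℝ) (τ t : ℝ) :
    phaseExp (fun v => τ * a v) t = phaseExp a (τ * t) := by
  unfold phaseExp
  congr 1
  funext v
  congr 1
  ring

lemma phaseExp_add (a : Fin c → ℝ) (t t' : ℝ) :
    phaseExp a (t + t') = (phaseExp a t).comp (phaseExp a t') := by
  unfold phaseExp
  rw [← phase_mul]
  congr 1
  funext v
  rw [Pi.mul_apply, ← Circle.exp_add, mul_add]

lemma IsAdaptedBasis.abs_le {U : CoinSpace c →ₗᵢ[ℂ] CoinSpace c} {a : Fin c → ℝ}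
    {b : OrthonormalBasis (Fin c) ℂ (CoinSpace c)} {l : Fin c → ℂ} {α : Fin c → ℝ}
    (h : IsAdaptedBasis U (realDiag a) b l α) (i : Fin c) : |α i| ≤ ∑ v, |a v| := by
  have h1 := h.inner_eq i (b i) (h.apply_eq i)
  rw [inner_self_eq_norm_sq_to_K, b.norm_eq_one] at h1
  have h2 : |α i| = ‖inner ℂ (b i) (realDiag a (b i))‖ := by
    rw [h1]; simp
  have hb : ∀ v, ‖b i v‖ ≤ 1 := fun v => by
    simpa [b.norm_eq_one] using PiLp.norm_apply_le (b i) v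
  rw [h2, PiLp.inner_apply]
  refine norm_sum_le_of_le _ fun v _ => ?_
  refine (norm_inner_le_norm _ _).trans ?_
  rw [diagMap_apply, norm_mul, Complex.norm_real, Real.norm_eq_abs]
  have h3 := mul_le_mul (hb v) (hb v) (norm_nonneg _) zero_le_one
  nlinarith [abs_nonneg (a v)]

/-- Rescaling the isometry by a phase does not affect adapted bases. -/
lemma IsAdaptedBasis.smul {U V : CoinSpace c →ₗᵢ[ℂ] CoinSpace c} {A : CoinSpace c →ₗ[ℂ] CoinSpace c}
    {b : OrthonormalBasis (Fin c) ℂ (CoinSpace c)} {l : Fin c → ℂ} {α : Fin c → ℝ}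
    (h : IsAdaptedBasis U A b l α) {e : ℂ} (he : ‖e‖ = 1) (hV : ∀ x, V x = e • U x) :
    IsAdaptedBasis V A b (fun i => e * l i) α where
  norm_eq_one i := by rw [norm_mul, he, h.norm_eq_one, one_mul]
  apply_eq i := by rw [hV, h.apply_eq, smul_smul]
  inner_eq i w hw := by
    refine h.inner_eq i w ?_
    have he0 : e ≠ 0 := norm_ne_zero_iff.1 (by rw [he]; exact one_ne_zero)
    rw [hV, mul_smul] at hw
    exact smul_right_injective _ he0 hw

end Isometries

namespace QRW

open Complex

variable {d c : ℕ}

lemma phaseExp_driftDot_symbol (W : QRW d c) (s θ : Fin d → ℝ) (t : ℝ) (z : Torus d)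
    (x : CoinSpace c) : ((phaseExp (W.driftDot s θ) t).comp (W.symbol z)) x =
      (Circle.exp (-(t * ∑ i, s i * θ i)) : ℂ) • W.symbol (z + torusPt (t • θ)) x := by
  rw [symbol_add_torusPt]
  ext v
  simp only [LinearIsometry.coe_comp, Function.comp_apply, phaseExp, phase_apply,
    PiLp.smul_apply, smul_eq_mul, driftDot_eq]
  rw [← mul_assoc, ← Circle.coe_mul, ← Circle.exp_add]
  congr 3
  ring

lemma continuous_torusPt_smul (θ : Fin d → ℝ) : Continuous fun t : ℝ => torusPt (t • θ) := by
  unfold torusPt torusMk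
  refine continuous_pi fun i => ?_
  exact (AddCircle.continuous_mk' 1).comp (by fun_prop)

/-- A property holds almost everywhere if and only if it holds almost everywhere along almost
every line of a given direction. -/
lemma ae_iff_ae_ae_line (θ : Fin d → ℝ) {p : Torus d → Prop} (hp : MeasurableSet {z | p z}) :
    (∀ᵐ z, p z) ↔ ∀ᵐ z, ∀ᵐ t : ℝ, p (z + torusPt (t • θ)) := by
  have hmeas : MeasurableSet {x : Torus d × ℝ | p (x.1 + torusPt (x.2 • θ))} :=
    (continuous_fst.add ((continuous_torusPt_smul θ).comp continuous_snd)).measurable hp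
  -- Fubini exchanges the quantifiers; for fixed t, translation preserves the measure.
  rw [Measure.ae_ae_comm hmeas]
  have h : ∀ t : ℝ, (∀ᵐ z, p (z + torusPt (t • θ))) ↔ ∀ᵐ z, p z := by
    intro t
    have h1 := measurePreserving_add_right (volume : Measure (Torus d)) (torusPt (t • θ))
    rw [ae_iff, ae_iff]
    exact iff_of_eq (congrArg (· = 0) (h1.measure_preimage hp.compl.nullMeasurableSet))
  simp only [h]
  rw [eventually_const]

lemma ae_ae_line (θ : Fin d → ℝ) {p : Torus d → Prop} (hp : ∀ᵐ z, p z) :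
    ∀ᵐ z, ∀ᵐ t : ℝ, p (z + torusPt (t • θ)) := by
  obtain ⟨B, hB, hBm, hB0⟩ := exists_measurable_superset_of_null (ae_iff.1 hp)
  have h1 : ∀ᵐ z : Torus d, z ∈ Bᶜ := by rw [ae_iff]; simpa using hB0
  refine ((ae_iff_ae_ae_line θ hBm.compl).1 h1).mono fun z hz => hz.mono fun t ht => ?_
  by_contra hcon
  exact ht (hB hcon)

/-- Along a generic line, almost all stationary eigenvalues belong to flat bands. -/
lemma ae_isFlat_line (W : QRW d c) {s θ : Fin d → ℝ}
    (hθ : ∀ b ∈ driftGroup s, ∑ i, b i * θ i = 0 → b = 0) (z : Torus d) :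
    ∀ᵐ t : ℝ, ∀ (b : OrthonormalBasis (Fin c) ℂ (CoinSpace c)) (l : Fin c → ℂ) (α : Fin c → ℝ),
      IsAdaptedBasis (W.symbol (z + torusPt (t • θ))) (realDiag (W.driftDot s θ)) b l α →
        ∀ i, α i = 0 → W.IsFlat s (z + torusPt (t • θ)) (l i) := by
  filter_upwards [ae_det_eq_zero_of_stationary (W.symbol z) (W.driftDot s θ)] with t ht b l α h i hi
  set σ := ∑ i, s i * θ i
  set e : ℂ := ((Circle.exp (-(t * σ)) : Circle) : ℂ) with he
  have he1 : ‖e‖ = 1 := Circle.norm_coe _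
  have he0 : e ≠ 0 := norm_ne_zero_iff.1 (by rw [he1]; exact one_ne_zero)
  refine W.isFlat_of_generic_line hθ fun t' => ?_
  -- The analytic family is based at z and flatness at z + tθ, hence the shifted parameter t' + t.
  -- The two families differ by the scalar phase e.
  have h1 := ht b _ α (h.smul he1 (W.phaseExp_driftDot_symbol s θ t z)) i hi (t' + t)
  have h2 : (e * l i) • LinearMap.id -
      ((phaseExp (W.driftDot s θ) (t' + t)).comp (W.symbol z)).toLinearMap =
      e • (l i • LinearMap.id -
        ((phaseExp (W.driftDot s θ) t').comp (W.symbol (z + torusPt (t • θ)))).toLinearMap) := by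
    refine LinearMap.ext fun x => ?_
    have h3 := W.phaseExp_driftDot_symbol s θ t z x
    simp only [LinearIsometry.coe_comp, Function.comp_apply] at h3
    simp [phaseExp_add, h3, smul_sub, smul_smul, he, σ]
  rw [h2, LinearMap.det_smul] at h1
  exact (mul_eq_zero.1 h1).resolve_left (pow_ne_zero _ he0)

end QRW

/-! ### From atoms to flat bands and strong localization. -/

namespace QRW

open Complex

variable {d c : ℕ}

/-- The averaged kicks detect the mass of the stationary eigenvectors. -/
lemma tendsto_average_kicks {q : ℝ} (x : ℝ) (hq : Complex.exp (I * (q : ℝ)) = 1 ↔ q = 0) :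
    Tendsto (fun N : ℕ => x * ‖∑ n ∈ Finset.range N, (N : ℂ)⁻¹ * exp (I * (n * q : ℝ))‖ ^ 2) atTop
      (𝓝 (if q = 0 then x else 0)) := by
  have h1 := tendsto_average_pow (q := Complex.exp (I * (q : ℝ)))
    (by rw [mul_comm, Complex.norm_exp_ofReal_mul_I])
  have h2 := ((h1.norm).pow 2).const_mul x
  have h3 : x * ‖(if Complex.exp (I * (q : ℝ)) = 1 then (1 : ℂ) else 0)‖ ^ 2 =
      if q = 0 then x else 0 := by
    simp only [hq]
    split_ifs <;> simp
  rw [h3] at h2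
  refine h2.congr fun N => ?_
  rw [Finset.mul_sum]
  congr 3
  refine Finset.sum_congr rfl fun n _ => ?_
  rw [← Complex.exp_nat_mul]
  congr 2
  push_cast
  ring

/-- The scale τ is so small that |τα| < 2π, so only a zero velocity yields the phase 1. -/
lemma exp_mul_eq_one_iff {C τ α : ℝ} (hα : |α| ≤ C) (hτ : τ = Real.pi / (C + 1)) :
    Complex.exp (I * (τ * α : ℝ)) = 1 ↔ τ * α = 0 := by
  have hC : 0 < C + 1 := by linarith [abs_nonneg α]
  constructor
  · intro h
    obtain ⟨n, hn⟩ := Complex.exp_eq_one_iff.1 h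
    have h1 : τ * α = n * (2 * Real.pi) := by
      have h2 : I * ((τ * α : ℝ) : ℂ) = I * ((n * (2 * Real.pi) : ℝ) : ℂ) := by
        rw [hn]; push_cast; ring
      exact_mod_cast mul_left_cancel₀ I_ne_zero h2
    have h3 : |τ * α| < 2 * Real.pi := by
      rw [abs_mul, hτ, abs_of_pos (div_pos Real.pi_pos hC), div_mul_eq_mul_div, div_lt_iff₀ hC]
      nlinarith [Real.pi_pos, abs_nonneg α]
    rw [h1, abs_mul, abs_of_pos Real.two_pi_pos] at h3
    have h4 : |(n : ℝ)| < 1 := by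
      by_contra hcon
      nlinarith [Real.two_pi_pos]
    have h5 : n = 0 := Int.abs_lt_one_iff.1 (by exact_mod_cast h4)
    rw [h1, h5]; simp
  · intro h
    rw [h]; simp

/-- The average of the characters `x ↦ e^{inτ θ·(x-s)}`. -/
def probe (s θ : Fin d → ℝ) (τ : ℝ) (N : ℕ) (x : EuclideanSpace ℝ (Fin d)) : ℝ :=
  ‖∑ n ∈ Finset.range N, (N : ℂ)⁻¹ * exp (I * (n * (τ * ∑ i, (x i - s i) * θ i) : ℝ))‖ ^ 2

lemma norm_average_le (N : ℕ) {F : Type*} [NormedAddCommGroup F] [NormedSpace ℂ F] (f : ℕ → F)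
    (hf : ∀ n, ‖f n‖ ≤ 1) : ‖∑ n ∈ Finset.range N, (N : ℂ)⁻¹ • f n‖ ≤ 1 := by
  refine (norm_sum_le_of_le _ (n := fun _ => (N : ℝ)⁻¹) fun n _ => ?_).trans ?_
  · rw [norm_smul, norm_inv, Complex.norm_natCast]
    exact mul_le_of_le_one_right (by positivity) (hf n)
  · rw [Finset.sum_const, Finset.card_range, nsmul_eq_mul]
    exact mul_inv_le_one

/-- The test function `probe` as a bounded continuous function. -/
def probeBCF (s θ : Fin d → ℝ) (τ : ℝ) (N : ℕ) :
    BoundedContinuousFunction (EuclideanSpace ℝ (Fin d)) ℝ :=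
  BoundedContinuousFunction.ofNormedAddCommGroup (probe s θ τ N)
    (by unfold probe; fun_prop) 1 (by
      intro x
      rw [Real.norm_eq_abs, probe, abs_of_nonneg (by positivity)]
      refine pow_le_one₀ (norm_nonneg _) (norm_average_le N _ fun n => ?_)
      rw [mul_comm, Complex.norm_exp_ofReal_mul_I])

/-- In momentum space the characters of the position become kicks, and the phases caused by the
drift s go into the coefficients of the trigonometric polynomial. -/
lemma integral_probe (W : QRW d c) (u : CoinSpace c) (s θ : Fin d → ℝ) (τ : ℝ) (N : ℕ) {T : ℕ}
    (hT : T ≠ 0) : ∫ x, probe s θ τ N x ∂(W.rescaledMeasure u T) =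
      ∫ z, ‖∑ n ∈ Finset.range N, (N : ℂ)⁻¹ • (((phaseExp (fun v => (n * τ) * W.driftDot s θ v)
        (T : ℝ)⁻¹).comp (W.symbol z)) ^ T) u‖ ^ 2 := by
  have hT' : (T : ℝ) ≠ 0 := by exact_mod_cast hT
  set σ := ∑ i, s i * θ i with hσ
  have h1 : ∀ z (n : ℕ), (((phaseExp (fun v => (n * τ) * W.driftDot s θ v)
      (T : ℝ)⁻¹).comp (W.symbol z)) ^ T) u = (Circle.exp (-(n * τ * σ)) : ℂ) •
        ((W.symbol (z + torusPt ((n * τ * (T : ℝ)⁻¹) • θ))) ^ T) u := by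
    intro z n
    rw [phaseExp_mul, pow_apply_of_eq_smul (W.phaseExp_driftDot_symbol s θ _ z), ← Circle.coe_pow,
      ← Circle.exp_nsmul]
    congr 3
    rw [nsmul_eq_mul, ← hσ]
    field_simp
  simp only [h1, smul_smul]
  rw [← W.sum_siteProb_trigPoly u T, integral_rescaledMeasure]
  refine Finset.sum_congr rfl fun x _ => ?_
  rw [smul_eq_mul, mul_comm, probe]
  congr 3
  refine Finset.sum_congr rfl fun n _ => ?_
  rw [mul_assoc, torusChar_torusPt, ← Circle.coe_mul, ← Circle.exp_add, Circle.coe_exp, mul_comm I]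
  congr 4
  rw [hσ]
  simp only [latticePoint, PiLp.smul_apply, Pi.smul_apply, smul_eq_mul, sub_mul,
    Finset.sum_sub_distrib]
  rw [mul_sub, mul_sub, sub_eq_neg_add]
  congr 1
  · ring
  · rw [Finset.mul_sum, Finset.mul_sum]
    refine Finset.sum_congr rfl fun i _ => ?_
    ring

/-- The mass of an atom is bounded by the mean mass of the stationary eigenvectors. -/
lemma exists_stationaryMass (W : QRW d c) {u : CoinSpace c} {hu : ‖u‖ = 1}
    {μ : ProbabilityMeasure (EuclideanSpace ℝ (Fin d))} (hμ : W.IsLimitMeasure u hu μ)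
    (s : EuclideanSpace ℝ (Fin d)) (θ : Fin d → ℝ) :
    ∃ F : Torus d → ℝ, Measurable F ∧
      (μ : Measure (EuclideanSpace ℝ (Fin d))).real {s} ≤ ∫ z, F z ∧
      ∀ z, F z ≠ 0 → ∃ (b : OrthonormalBasis (Fin c) ℂ (CoinSpace c)) (l : Fin c → ℂ)
        (α : Fin c → ℝ), IsAdaptedBasis (W.symbol z) (realDiag (W.driftDot s θ)) b l α ∧ ∃ i, α i = 0 ∧ inner ℂ (b i) u ≠ 0 := by
  have hbasis : ∀ z, ∃ (b : OrthonormalBasis (Fin c) ℂ (CoinSpace c)) (l α : _),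
      IsAdaptedBasis (W.symbol z) (realDiag (W.driftDot s θ)) b l α := fun z =>
    LinearIsometry.exists_isAdaptedBasis (by simp) _ (isSymmetric_realDiag _)
  choose b l α hb using hbasis
  set a := W.driftDot s θ with ha
  set τ := Real.pi / (∑ v, |a v| + 1) with hτ
  have hτ0 : τ ≠ 0 := by
    have : 0 ≤ ∑ v, |a v| := by positivity
    have := Real.pi_pos
    positivity
  set G : ℕ → ℕ → Torus d → ℝ := fun N T z => ‖∑ n ∈ Finset.range N, (N : ℂ)⁻¹ •
    (((phaseExp (fun v => (n * τ) * a v) (T : ℝ)⁻¹).comp (W.symbol z)) ^ T) u‖ ^ 2 with hG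
  set H : ℕ → Torus d → ℝ := fun N z => ∑ i, ‖inner ℂ (b z i) u‖ ^ 2 *
    ‖∑ n ∈ Finset.range N, (N : ℂ)⁻¹ * exp (I * (n * (τ * α z i) : ℝ))‖ ^ 2 with hH
  -- The mass of u on the stationary eigenvectors. It arises from `G` by letting T → ∞ at fixed N,
  -- then N → ∞, and this also gives its measurability.
  set F : Torus d → ℝ := fun z => ∑ i, if τ * α z i = 0 then ‖inner ℂ (b z i) u‖ ^ 2 else 0 with hF
  have hGH : ∀ N z, Tendsto (fun T => G N T z) atTop (𝓝 (H N z)) := by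
    intro N z
    have h := (hb z).tendsto_norm_sum_pow u (Finset.range N) (fun _ => (N : ℂ)⁻¹) (fun n => n * τ)
    simpa only [hG, hH, mul_assoc] using h
  have hHF : ∀ z, Tendsto (fun N => H N z) atTop (𝓝 (F z)) := fun z =>
    tendsto_finsetSum _ fun i _ => tendsto_average_kicks _
      (exp_mul_eq_one_iff ((hb z).abs_le i) hτ)
  have hGc : ∀ N T, Continuous (G N T) := by
    intro N T
    refine (continuous_norm.comp (continuous_finsetSum _ fun n _ => ?_)).pow 2
    have h1 : ∀ z, (((phaseExp (fun v => (n * τ) * a v) (T : ℝ)⁻¹).comp (W.symbol z)) ^ T) u =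
        (Circle.exp (-(n * τ * (T : ℝ)⁻¹ * ∑ i, s i * θ i)) : ℂ) ^ T •
          ((W.symbol (z + torusPt ((n * τ * (T : ℝ)⁻¹) • θ))) ^ T) u := fun z => by
      rw [phaseExp_mul, pow_apply_of_eq_smul (W.phaseExp_driftDot_symbol s θ _ z)]
    simp only [h1]
    have h2 := (W.continuous_symbol_pow_apply u T).comp
      (continuous_add_const (torusPt ((n * τ * (T : ℝ)⁻¹) • θ)))
    exact (h2.const_smul (_ : ℂ)).const_smul (_ : ℂ)
  have hG0 : ∀ N T z, 0 ≤ G N T z := fun N T z => by positivity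
  have hG1 : ∀ N T z, G N T z ≤ 1 := fun N T z =>
    pow_le_one₀ (norm_nonneg _) (norm_average_le N _ fun n => by
      rw [LinearIsometry.norm_map, hu])
  have hGn : ∀ N T z, ‖G N T z‖ ≤ 1 := fun N T z => by
    rw [Real.norm_eq_abs, abs_of_nonneg (hG0 N T z)]; exact hG1 N T z
  have hHm : ∀ N, Measurable (H N) := fun N =>
    measurable_of_tendsto_metrizable (fun T => (hGc N T).measurable)
      (tendsto_pi_nhds.2 fun z => hGH N z)
  have hHn : ∀ N z, ‖H N z‖ ≤ 1 := fun N z =>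
    le_of_tendsto' (hGH N z).norm fun T => hGn N T z
  have hFm : Measurable F := measurable_of_tendsto_metrizable hHm
    (tendsto_pi_nhds.2 fun z => hHF z)
  refine ⟨F, hFm, ?_, ?_⟩
  · have hlim : Tendsto (fun N => ∫ z, H N z) atTop (𝓝 (∫ z, F z)) :=
      tendsto_integral_of_dominated_convergence (fun _ => 1)
        (fun N => (hHm N).aestronglyMeasurable) (integrable_const 1)
        (fun N => Eventually.of_forall (hHn N)) (Eventually.of_forall hHF)
    refine ge_of_tendsto hlim ?_
    filter_upwards [eventually_ne_atTop 0] with N hN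
    have h1 : Tendsto (fun T => ∫ z, G N T z) atTop (𝓝 (∫ z, H N z)) :=
      tendsto_integral_of_dominated_convergence (fun _ => 1)
        (fun T => (hGc N T).aestronglyMeasurable) (integrable_const 1)
        (fun T => Eventually.of_forall (hGn N T)) (Eventually.of_forall (hGH N))
    have h2 := (ProbabilityMeasure.tendsto_iff_forall_integral_tendsto.1 hμ) (probeBCF s θ τ N)
    have h3 : ∫ z, H N z = ∫ x, probe s θ τ N x ∂(μ : Measure (EuclideanSpace ℝ (Fin d))) := by
      refine tendsto_nhds_unique h1 (h2.congr' ?_)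
      filter_upwards [eventually_ne_atTop 0] with T hT
      exact W.integral_probe u s θ τ N hT
    rw [h3]
    -- As the probe is nonnegative and equals 1 at s, Markov's inequality bounds the atom by its
    -- integral.
    have h4 : probe s θ τ N s = 1 := by
      have : (N : ℂ) ≠ 0 := by exact_mod_cast hN
      simp [probe, this]
    have h5 := mul_meas_ge_le_integral_of_nonneg (μ := (μ : Measure (EuclideanSpace ℝ (Fin d))))
      (f := probe s θ τ N) (Eventually.of_forall fun x => by unfold probe; positivity)
      ((probeBCF s θ τ N).integrable _) 1
    rw [one_mul] at h5
    refine le_trans ?_ h5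
    refine measureReal_mono ?_
    intro x hx
    rw [Set.mem_singleton_iff.1 hx]
    exact h4.ge
  · intro z hz
    obtain ⟨i, -, hi⟩ := Finset.exists_ne_zero_of_sum_ne_zero hz
    have hi' : τ * α z i = 0 := by
      by_contra hcon
      exact hi (if_neg hcon)
    rw [if_pos hi'] at hi
    refine ⟨b z, l z, α z, hb z, i, (mul_eq_zero.1 hi').resolve_left hτ0, fun h0 => hi ?_⟩
    rw [h0]; simp

/-- If there is an atom at `s`, then the initial state overlaps with flat bands of velocity `s`
on a set of momenta which is not negligible. -/
lemma not_ae_inner_eq_zero_of_isAtom (W : QRW d c) {u : CoinSpace c} {hu : ‖u‖ = 1}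
    {μ : ProbabilityMeasure (EuclideanSpace ℝ (Fin d))} (hμ : W.IsLimitMeasure u hu μ)
    {s : EuclideanSpace ℝ (Fin d)} (hs : IsAtom μ s) :
    ¬ ∀ᵐ z, ∀ (l : ℂ) (x : CoinSpace c), W.symbol z x = l • x → ‖l‖ = 1 → W.IsFlat s z l →
      inner ℂ x u = 0 := by
  intro hae
  obtain ⟨θ, hθ⟩ := exists_generic_direction (driftGroup (s : Fin d → ℝ))
  obtain ⟨F, hFm, hF, hFz⟩ := W.exists_stationaryMass hμ s θ
  have h1 : ∀ᵐ z, F z = 0 := by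
    -- Flatness of stationary eigenvalues is known only along lines of direction θ, so the vanishing
    -- of F is checked line by line.
    rw [ae_iff_ae_ae_line θ (p := fun z => F z = 0) (hFm (measurableSet_singleton 0))]
    filter_upwards [ae_ae_line θ hae] with z hz
    filter_upwards [hz, W.ae_isFlat_line hθ z] with t ht hflat
    by_contra hne
    obtain ⟨b, l, α, hb, i, hi, hne'⟩ := hFz _ hne
    exact hne' (ht (l i) (b i) (hb.apply_eq i) (hb.norm_eq_one i) (hflat b l α hb i hi))
  rw [integral_congr_ae h1, integral_zero] at hF
  have h2 : 0 < (μ : Measure (EuclideanSpace ℝ (Fin d))).real {s} :=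
    ENNReal.toReal_pos hs.ne' (measure_ne_top _ _)
  exact absurd hF (not_le.2 h2)

/-- An atom sits at a rational speed, and the amplitude along the corresponding ray does not tend
to zero. -/
lemma exists_not_tendsto_of_isAtom (W : QRW d c) {u : CoinSpace c} {hu : ‖u‖ = 1}
    {μ : ProbabilityMeasure (EuclideanSpace ℝ (Fin d))} (hμ : W.IsLimitMeasure u hu μ)
    {s : EuclideanSpace ℝ (Fin d)} (hs : IsAtom μ s) :
    ∃ (k : ℕ) (m : Fin d → ℤ), 1 ≤ k ∧ k ≤ c ∧ (∀ i, k * s i = m i) ∧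
      ¬ Tendsto (fun n : ℕ => W.waveFun u (k * n) (n • m)) atTop (𝓝 0) := by
  by_contra hcon
  push Not at hcon
  refine W.not_ae_inner_eq_zero_of_isAtom hμ hs ?_
  -- The data k, m and r range over a countable set, so a single null set of momenta serves for all
  -- flat bands at once.
  have h1 : ∀ (k : ℕ) (m : Fin d → ℤ) (r : (W.symbol 0).toLinearMap.charpoly.roots.toFinset),
      ∀ᵐ z, 1 ≤ k → k ≤ c → (∀ i, k * s i = m i) → ‖(r : ℂ)‖ = 1 → ∀ (l : ℂ) (x : CoinSpace c),
        W.symbol z x = l • x → l ^ k = (r : ℂ) ^ k * torusChar m z → inner ℂ x u = 0 := by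
    intro k m r
    by_cases h : 1 ≤ k ∧ k ≤ c ∧ (∀ i, k * s i = m i) ∧ ‖(r : ℂ)‖ = 1
    · obtain ⟨hk1, hkc, hkm, hr⟩ := h
      filter_upwards [W.ae_inner_eq_zero_of_tendsto hu (hcon k m hk1 hkc hkm)
        (μ := (r : ℂ) ^ k) (by rw [norm_pow, hr, one_pow])] with z hz _ _ _ _
      exact hz
    · exact Eventually.of_forall fun z hk1 hkc hkm hr => absurd ⟨hk1, hkc, hkm, hr⟩ h
  have h2 := ae_all_iff.2 fun k => ae_all_iff.2 fun m => ae_all_iff.2 (h1 k m)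
  filter_upwards [h2] with z hz l x hx hl hflat
  have hl0 : l ≠ 0 := norm_ne_zero_iff.1 (by rw [hl]; exact one_ne_zero)
  obtain ⟨k, hk1, hkc, m, hkm⟩ := hflat.exists_nat_smul_eq hl0
  obtain ⟨r, hr, hrl, hlk⟩ := hflat.exists_pow_eq hkm
  exact hz k m ⟨r, Multiset.mem_toFinset.2 hr⟩ hk1 hkc hkm (hrl.trans hl) l x hx hlk

lemma mem_fractionLattice {s : EuclideanSpace ℝ (Fin d)} {k : ℕ} (hk : 1 ≤ k) {m : Fin d → ℤ}
    (h : ∀ i, k * s i = m i) : s ∈ fractionLattice d k := by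
  refine ⟨m, ?_⟩
  ext i
  have : (k : ℝ) ≠ 0 := by exact_mod_cast (by omega : k ≠ 0)
  simp only [PiLp.smul_apply, latticePoint, smul_eq_mul]
  rw [← h i]
  field_simp

end QRW

end

/-! ### The quantization theorem. -/

theorem mainTheorem6 {d c : ℕ} (W : QRW d c) :
    -- the limit measures exist
    (∀ (u : CoinSpace c) (hu : ‖u‖ = 1), ∃ μ, W.IsLimitMeasure u hu μ) ∧
    -- every atom of a limit measure lies in `(1/k) ℤ^d ∩ P` for some `1 ≤ k ≤ c`
    (∀ (u : CoinSpace c) (hu : ‖u‖ = 1) (μ : ProbabilityMeasure (EuclideanSpace ℝ (Fin d))),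
      W.IsLimitMeasure u hu μ → ∀ s, QRW.IsAtom μ s →
        ∃ k : ℕ, 1 ≤ k ∧ k ≤ c ∧ s ∈ QRW.fractionLattice d k ∩ W.jumpHull) ∧
    -- an atom at such a point gives strong localization at that speed
    (∀ (u : CoinSpace c) (hu : ‖u‖ = 1) (μ : ProbabilityMeasure (EuclideanSpace ℝ (Fin d))),
      W.IsLimitMeasure u hu μ →
        ∀ k : ℕ, 1 ≤ k → k ≤ c → ∀ s ∈ QRW.fractionLattice d k ∩ W.jumpHull,
          QRW.IsAtom μ s → W.StronglyLocalizesAt u s) ∧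
    -- the speeds of localization are rational, with a common denominator at most `c`
    (∀ (u : CoinSpace c), ‖u‖ = 1 → ∀ s, W.StronglyLocalizesAt u s →
      ∃ k : ℕ, 1 ≤ k ∧ k ≤ c ∧ s ∈ QRW.fractionLattice d k) := by
  refine ⟨W.exists_isLimitMeasure, fun u hu μ hμ s hs => ?_, fun u hu μ hμ k _ _ s hs' hs => ?_,
    fun u hu s hs => ?_⟩
  · obtain ⟨k, m, hk1, hkc, hkm, -⟩ := W.exists_not_tendsto_of_isAtom hμ hs
    exact ⟨k, hk1, hkc, QRW.mem_fractionLattice hk1 hkm, W.mem_jumpHull_of_isAtom hμ hs⟩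
  · obtain ⟨k, m, hk1, hkc, hkm, h⟩ := W.exists_not_tendsto_of_isAtom hμ hs
    exact W.stronglyLocalizesAt_of_not_tendsto hu hs'.2 hk1 hkm h
  · obtain ⟨μ, hμ⟩ := W.exists_isLimitMeasure u hu
    obtain ⟨k, m, hk1, hkc, hkm, -⟩ :=
      W.exists_not_tendsto_of_isAtom hμ (W.isAtom_of_stronglyLocalizesAt hμ hs)
    exact ⟨k, hk1, hkc, QRW.mem_fractionLattice hk1 hkm⟩
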